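/- Let $G$ be a finite simple connected graph with vertex set $V$, and let $B\subset V$ be such that no two vertices of $B$ are adjacent and every vertex of $B$ is adjacent to some vertex of $\Omega=V\setminus B$ (so $(G,B)$ is a graph with boundary). Equip $G$ with the unit weight, so that $\Delta u(x)=\sum_{y\sim x}(u(y)-u(x))$ for $u\in\mathbb R^V$. For $f\in\mathbb R^B$ let $u_f\in\mathbb R^V$ be the unique function with $u_f=f$ on $B$ and $\Delta u_f=0$ on $\Omega$, and let $\Lambda f=-\Delta u_f|_B$ be the Dirichlet-to-Neumann map $\Lambda:\mathbb R^B\to\mathbb R^B$. It is self-adjoint; its eigenvalues, repeated according to multiplicity, are the Steklov eigenvalues $0=\sigma_1<\sigma_2\le\dots\le\sigma_{|B|}$. **Theorem.** Let $2\le i\le |B|$ and $k=\left\lfloor |V|/i\right\rfloor$. 1. If $i\nmid |V|$, then $$\sigma_i\ \ge\ 2-2\cos\frac{\pi}{2k+1}.$$ If $|V|\equiv 1 \pmod i$, then equality holds if and only if $k=1$, that is, $|V|=i+1$, and $G$ is a star of degree $i$ with each arm of length $1$ (one center $o$ adjacent to the $i$ other vertices, and no further edges), with $B$ the set of the $i$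 end points of the arms, $B=V\setminus\{o\}$. 2. If $i\mid |V|$, then $$\sigma_i\ >\ \mathcal P(k,\lambda_i).$$ Here $\lambda_i$ is the largest eigenvalue of $-\Delta$ on the path with $i$ vertices and the unit weight. For $k\ge 1$ and $\lambda>0$, $\mathcal P(k,\lambda)$ is the first Dirichlet eigenvalue of the path with vertices $0,1,\dots,k$, edge weights $w_{01}=\lambda$ and $w_{12}=\dots=w_{k-1,k}=1$, unit vertex measure and boundary $\{0\}$: the smallest $\mu\in\mathbb R$ for which there is a nonzero $u$ on $\{0,\dots,k\}$ with $u(0)=0$ and $\sum_{y}(u(x)-u(y))\,w_{xy}=\mu\, u(x)$ for $x=1,\dots,k$. -/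

import Mathlib

namespace SteklovGraph

noncomputable section

/-- `i`-th (`i = 1, 2, …`) entry of the nondecreasing list of the real eigenvalues of `T`, repeated
according to multiplicity (roots of the characteristic polynomial). All operators to which this is
applied below are self-adjoint, so the list has as many entries as the dimension of the space; see
`card_roots_charpoly_of_symmetric`. Junk value `0` for an index outside `1, …, dim`. -/
def orderedEigenvalue {ι : Type*} [Finite ι] (T : Module.End ℝ (ι → ℝ)) (i : ℕ) : ℝ :=
  (T.charpoly.roots.sort (· ≤ ·)).getD (i - 1) 0

section Weighted

variable {V : Type*} [Fintype V]

/-- The Laplacian `Δu(x) = (1 / m_x) ∑_y (u(y) - u(x)) w_xy` for the vertex measure `m` and the edge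
weight `w`, extended by zero to pairs of vertices that are not joined by an edge. -/
def laplacian (m : V → ℝ) (w : V → V → ℝ) : Module.End ℝ (V → ℝ) where
  toFun u x := (1 / m x) * ∑ y, (u y - u x) * w x y
  map_add' u v := by
    funext x
    simp only [Pi.add_apply, ← mul_add, ← Finset.sum_add_distrib]
    congr 1
    exact Finset.sum_congr rfl fun y _ => by ring
  map_smul' c u := by
    funext x
    simp only [Pi.smul_apply, smul_eq_mul, RingHom.id_apply, Finset.mul_sum]
    exact Finset.sum_congr rfl fun y _ => by ring

/-- The normal derivative `∂u/∂n(x) = (1 / m_x) ∑_y (u(x) - u(y)) w_xy = -Δu(x)` at `x ∈ B`. -/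
def normalDerivative (m : V → ℝ) (w : V → V → ℝ) (B : Set V) : (V → ℝ) →ₗ[ℝ] (B → ℝ) :=
  LinearMap.funLeft ℝ ℝ (Subtype.val : B → V) ∘ₗ (-laplacian m w)

open Classical in
/-- The operator of the Dirichlet problem: `u ↦ (u on B, Δu off B)`. -/
def dirichletProblem (m : V → ℝ) (w : V → V → ℝ) (B : Set V) : Module.End ℝ (V → ℝ) where
  toFun u x := if x ∈ B then u x else laplacian m w u x
  map_add' u v := by
    funext x
    by_cases hx : x ∈ B <;> simp [hx]
  map_smul' c u := by
    funext x
    by_cases hx : x ∈ B <;> simp [hx]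

/-- The harmonic extension `u_f` of `f : B → ℝ`, that is, the solution of `Δu = 0` off `B`, `u = f` on
`B`. It exists and is unique for connected weighted graphs with `B` nonempty, see
`eq_harmonicExtension_iff`. -/
def harmonicExtension (m : V → ℝ) (w : V → V → ℝ) (B : Set V) : (B → ℝ) →ₗ[ℝ] (V → ℝ) :=
  Ring.inverse (dirichletProblem m w B) ∘ₗ
    Function.ExtendByZero.linearMap ℝ (Subtype.val : B → V)

/-- The Dirichlet-to-Neumann map `Λ f = ∂u_f/∂n`. -/
def dirichletToNeumann (m : V → ℝ) (w : V → V → ℝ) (B : Set V) : Module.End ℝ (B → ℝ) :=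
  normalDerivative m w B ∘ₗ harmonicExtension m w B

/-- The Dirichlet Laplacian on functions on `Ω = V ∖ B`: extend by zero to `B`, apply `-Δ`, and
restrict to `Ω`. -/
def dirichletLaplacian (m : V → ℝ) (w : V → V → ℝ) (B : Set V) :
    Module.End ℝ ((Bᶜ : Set V) → ℝ) :=
  LinearMap.funLeft ℝ ℝ (Subtype.val : (Bᶜ : Set V) → V) ∘ₗ (-laplacian m w) ∘ₗ
    Function.ExtendByZero.linearMap ℝ (Subtype.val : (Bᶜ : Set V) → V)

/-- The `i`-th Steklov eigenvalue `σ_i`, for `1 ≤ i ≤ |B|`. -/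
def steklovEigenvalue (m : V → ℝ) (w : V → V → ℝ) (B : Set V) (i : ℕ) : ℝ :=
  orderedEigenvalue (dirichletToNeumann m w B) i

/-- The `i`-th Laplacian eigenvalue `μ_i`, for `1 ≤ i ≤ |V|`. -/
def laplacianEigenvalue (m : V → ℝ) (w : V → V → ℝ) (i : ℕ) : ℝ :=
  orderedEigenvalue (-laplacian m w) i

/-- The first Dirichlet eigenvalue with respect to `B`. -/
def firstDirichletEigenvalue (m : V → ℝ) (w : V → V → ℝ) (B : Set V) : ℝ :=
  orderedEigenvalue (dirichletLaplacian m w B) 1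

end Weighted

open Classical in
/-- The unit edge weight of `G`, extended by zero to non-adjacent pairs. -/
def unitWeight {V : Type*} (G : SimpleGraph V) (x y : V) : ℝ := if G.Adj x y then 1 else 0

/-- `(G, B)` is a graph with boundary: no two vertices of `B` are adjacent, and every vertex of `B` is
adjacent to a vertex outside `B`. -/
structure IsGraphWithBoundary {V : Type*} (G : SimpleGraph V) (B : Set V) : Prop where
  not_adj : ∀ x ∈ B, ∀ y ∈ B, ¬ G.Adj x y
  exists_adj : ∀ x ∈ B, ∃ y ∉ B, G.Adj x y

/-- `λ_i`: the largest Laplacian eigenvalue of the path on `i` vertices with the unit weight. -/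
def pathTopEigenvalue (i : ℕ) : ℝ :=
  laplacianEigenvalue (fun _ : Fin i => (1 : ℝ)) (unitWeight (SimpleGraph.pathGraph i)) i

/-- The edge weight on the path `0, 1, …, k` that is `lam` on the edge `{0, 1}` and `1` on every other
edge. -/
def pathWeight (k : ℕ) (lam : ℝ) (x y : Fin (k + 1)) : ℝ :=
  (if x = 0 ∨ y = 0 then lam else 1) * unitWeight (SimpleGraph.pathGraph (k + 1)) x y

/-- `𝒫(k, lam)`: the first Dirichlet eigenvalue of the path `0, 1, …, k` with unit vertex measure, edge
weight `pathWeight k lam` and boundary `{0}`. -/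
def pathDirichlet (k : ℕ) (lam : ℝ) : ℝ :=
  firstDirichletEigenvalue (fun _ : Fin (k + 1) => (1 : ℝ)) (pathWeight k lam) {0}

theorem card_roots_charpoly_of_symmetric {ι : Type*} [Fintype ι] (T : Module.End ℝ (ι → ℝ))
    (hT : ∀ f g, ∑ x, T f x * g x = ∑ x, f x * T g x) :
    T.charpoly.roots.card = Fintype.card ι := by
  classical
  have hA : (LinearMap.toMatrix' T).IsHermitian := by
    ext x y
    have h := hT (Pi.single x 1) (Pi.single y 1)
    simpa [LinearMap.toMatrix'_apply, Pi.single_apply, eq_comm] using h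
  have h := hA.roots_charpoly_eq_eigenvalues
  have h2 : (LinearMap.toMatrix' T).charpoly = T.charpoly :=
    LinearMap.charpoly_toMatrix T (Pi.basisFun ℝ ι)
  rw [← h2, h]
  simp

section Weighted

variable {V : Type*} [Fintype V]

theorem energy_identity (m : V → ℝ) (w : V → V → ℝ) (hm : ∀ x, 0 < m x)
    (hs : ∀ x y, w x y = w y x) (u v : V → ℝ) :
    2 * ∑ x, m x * (laplacian m w u x * v x) = -∑ x, ∑ y, w x y * ((u y - u x) * (v y - v x)) := by
  have h1 : ∑ x, m x * (laplacian m w u x * v x) = ∑ x, ∑ y, w x y * ((u y - u x) * v x) := by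
    refine Finset.sum_congr rfl fun x _ => ?_
    have := (hm x).ne'
    simp only [laplacian, LinearMap.coe_mk, AddHom.coe_mk]
    rw [← mul_assoc, ← mul_assoc, mul_one_div_cancel this, one_mul, Finset.sum_mul]
    exact Finset.sum_congr rfl fun y _ => by ring
  have h2 : ∑ x, ∑ y, w x y * ((u y - u x) * v x) = ∑ x, ∑ y, w x y * ((u x - u y) * v y) := by
    rw [Finset.sum_comm]
    exact Finset.sum_congr rfl fun x _ => Finset.sum_congr rfl fun y _ => by rw [hs y x]
  rw [h1, two_mul]
  nth_rw 2 [h2]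
  rw [← Finset.sum_add_distrib, ← Finset.sum_neg_distrib]
  refine Finset.sum_congr rfl fun x _ => ?_
  rw [← Finset.sum_add_distrib, ← Finset.sum_neg_distrib]
  exact Finset.sum_congr rfl fun y _ => by ring

theorem isUnit_dirichletProblem (G : SimpleGraph V) (hG : G.Connected) (m : V → ℝ)
    (w : V → V → ℝ) (hm : ∀ x, 0 < m x) (hs : ∀ x y, w x y = w y x) (h0 : ∀ x y, 0 ≤ w x y)
    (hw : ∀ x y, G.Adj x y → 0 < w x y) (B : Set V) (hB : B.Nonempty) :
    IsUnit (dirichletProblem m w B) := by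
  classical
  rw [LinearMap.isUnit_iff_ker_eq_bot, LinearMap.ker_eq_bot']
  intro u hu
  have hx : ∀ x, (if x ∈ B then u x else laplacian m w u x) = 0 := fun x => congrFun hu x
  have hz : ∑ x, m x * (laplacian m w u x * u x) = 0 := by
    refine Finset.sum_eq_zero fun x _ => ?_
    have := hx x
    by_cases hxB : x ∈ B <;> simp_all
  have he := energy_identity m w hm hs u u
  rw [hz, mul_zero, eq_comm, neg_eq_zero] at he
  have hnn : ∀ x y, 0 ≤ w x y * ((u y - u x) * (u y - u x)) := fun x y =>
    mul_nonneg (h0 x y) (mul_self_nonneg _)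
  have hadj : ∀ x y, G.Adj x y → u x = u y := by
    intro x y hxy
    have h1 := (Finset.sum_eq_zero_iff_of_nonneg
      (fun x _ => Finset.sum_nonneg fun y _ => hnn x y)).1 he x (Finset.mem_univ x)
    have h2 := (Finset.sum_eq_zero_iff_of_nonneg (fun y _ => hnn x y)).1 h1 y (Finset.mem_univ y)
    rcases mul_eq_zero.1 h2 with h | h
    · exact absurd h (hw x y hxy).ne'
    · linarith [mul_self_eq_zero.1 h]
  have hconst : ∀ x y, u x = u y := by
    intro x y
    obtain ⟨p⟩ := hG.preconnected x y
    induction p with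
    | nil => rfl
    | cons h _ ih => exact (hadj _ _ h).trans ih
  obtain ⟨b, hb⟩ := hB
  have hub : u b = 0 := by simpa [hb] using hx b
  funext x
  rw [hconst x b, hub]
  rfl

theorem eq_harmonicExtension_iff (G : SimpleGraph V) (hG : G.Connected) (m : V → ℝ)
    (w : V → V → ℝ) (hm : ∀ x, 0 < m x) (hs : ∀ x y, w x y = w y x) (h0 : ∀ x y, 0 ≤ w x y)
    (hw : ∀ x y, G.Adj x y → 0 < w x y) (B : Set V) (hB : B.Nonempty) (f : B → ℝ) (u : V → ℝ) :
    u = harmonicExtension m w B f ↔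
      (∀ x : B, u x = f x) ∧ ∀ x ∉ B, laplacian m w u x = 0 := by
  have hU := isUnit_dirichletProblem G hG m w hm hs h0 hw B hB
  have key : u = harmonicExtension m w B f ↔
      dirichletProblem m w B u = Function.ExtendByZero.linearMap ℝ (Subtype.val : B → V) f := by
    constructor
    · rintro rfl
      have := Ring.mul_inverse_cancel _ hU
      exact congrArg (fun T : Module.End ℝ (V → ℝ) => T _) this
    · intro h
      have := Ring.inverse_mul_cancel _ hU
      have h3 : Ring.inverse (dirichletProblem m w B) (dirichletProblem m w B u) = u :=
        congrArg (fun T : Module.End ℝ (V → ℝ) => T u) this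
      rw [h] at h3
      exact h3.symm
  rw [key, funext_iff]
  have hon : ∀ x : B, Function.ExtendByZero.linearMap ℝ (Subtype.val : B → V) f x = f x := fun x =>
    Subtype.val_injective.extend_apply f (0 : V → ℝ) x
  have hoff : ∀ x ∉ B, Function.ExtendByZero.linearMap ℝ (Subtype.val : B → V) f x = 0 := by
    intro x hx
    exact Function.extend_apply' f (0 : V → ℝ) x fun ⟨a, ha⟩ => hx (ha ▸ a.2)
  constructor
  · intro h
    refine ⟨fun x => ?_, fun x hx => ?_⟩
    · rw [← hon x, ← h x]
      simp [dirichletProblem]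
    · rw [← hoff x hx, ← h x]
      simp [dirichletProblem, hx]
  · rintro ⟨h1, h2⟩ x
    by_cases hx : x ∈ B
    · rw [hon ⟨x, hx⟩, ← h1 ⟨x, hx⟩]
      simp [dirichletProblem, hx]
    · rw [hoff x hx, ← h2 x hx]
      simp [dirichletProblem, hx]

theorem card_roots_charpoly_dirichletToNeumann (G : SimpleGraph V) (hG : G.Connected)
    (w : V → V → ℝ) (hs : ∀ x y, w x y = w y x) (h0 : ∀ x y, 0 ≤ w x y)
    (hw : ∀ x y, G.Adj x y → 0 < w x y) (B : Set V) (hB : B.Nonempty) :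
    (dirichletToNeumann (fun _ => 1) w B).charpoly.roots.card = B.ncard := by
  classical
  rw [card_roots_charpoly_of_symmetric, ← Nat.card_eq_fintype_card, Nat.card_coe_set_eq]
  have hm : ∀ x : V, (0 : ℝ) < (fun _ => 1) x := fun _ => one_pos
  have key : ∀ f g : B → ℝ, 2 * ∑ x, dirichletToNeumann (fun _ => 1) w B f x * g x =
      ∑ x, ∑ y, w x y * ((harmonicExtension (fun _ => 1) w B f y -
        harmonicExtension (fun _ => 1) w B f x) * (harmonicExtension (fun _ => 1) w B g y -
        harmonicExtension (fun _ => 1) w B g x)) := by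
    intro f g
    have he := energy_identity (fun _ => 1) w hm hs (harmonicExtension (fun _ => 1) w B f)
      (harmonicExtension (fun _ => 1) w B g)
    obtain ⟨-, hf⟩ := (eq_harmonicExtension_iff G hG _ w hm hs h0 hw B hB f _).1 rfl
    obtain ⟨hg, -⟩ := (eq_harmonicExtension_iff G hG _ w hm hs h0 hw B hB g _).1 rfl
    rw [← neg_eq_iff_eq_neg] at he
    rw [← he, ← mul_neg, ← Finset.sum_neg_distrib]
    congr 1
    have h1 : ∑ x : B, dirichletToNeumann (fun _ => 1) w B f x * g x =
        ∑ x : B, (fun x : V => -(1 * (laplacian (fun _ => 1) w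
          (harmonicExtension (fun _ => 1) w B f) x *
          harmonicExtension (fun _ => 1) w B g x))) x.1 := by
      refine Finset.sum_congr rfl fun x _ => ?_
      rw [← hg x]
      simp [dirichletToNeumann, normalDerivative, LinearMap.funLeft_apply]
    rw [h1]
    refine Finset.sum_of_injOn Subtype.val Subtype.val_injective.injOn (by simp) ?_ (by simp)
    intro x _ hx
    rw [hf x fun h => hx ⟨⟨x, h⟩, by simp, rfl⟩]
    simp
  intro f g
  have h1 := key f g
  have h2 := key g f
  have h3 : ∑ x, f x * dirichletToNeumann (fun _ => 1) w B g x =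
      ∑ x, dirichletToNeumann (fun _ => 1) w B g x * f x :=
    Finset.sum_congr rfl fun x _ => mul_comm _ _
  rw [h3]
  refine mul_left_cancel₀ (two_ne_zero' ℝ) ?_
  rw [h1, h2]
  exact Finset.sum_congr rfl fun x _ => Finset.sum_congr rfl fun y _ => by ring

end Weighted

end

end SteklovGraph

/-! The harmonic extension `u` of `f` has energy `⟨Λf, f⟩`, and `∑ f² ≤ ∑ u²` over all of `V`. By
min-max it therefore suffices to find at most `i - 1` linear constraints on functions on `V` that
force energy `≥ c ∑ u²`; then `c ≤ σ_i` (`le_steklovEigenvalue`). If `σ_i = c` with `0 < c < 1`,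
then `u` must vanish off `B`. But `B` is independent, so such a `u` has energy at least `∑ u²`, a
contradiction. Hence the inequality is strict.

The constraints come from cutting a spanning tree into small connected pieces. On a connected piece,
sorting the values of `|u|` does not increase the energy, since the square of a difference dominates
the sum of the squared gaps it spans. Each piece is thus compared with a path, as in the Faber-Krahn
inequality.

For the first bound the constraints are zeros of `u` at chosen vertices. A greedy choice from the
leaves upwards spends one zero per `k + 1` vertices, and since `|V| < i (k + 1)` at most `i - 1`
zeros are needed. Each piece has a zero and at most `k` other vertices, so the constant is the
Dirichlet eigenvalue `2 - 2 cos (π / (2k + 1))` of a path.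

When `|V| = i k`, the constraints are instead sign changes with prescribed ratio across edges. If
`u(r₂) = -(b - 1) u(r₁)`, the edge energy splits exactly into the potentials `b u(r₁)²` and `b / (b
- 1) u(r₂)²`. Pieces of exactly `k` vertices are peeled off, each with potential of mass at least
`λ_i`, so that each has first eigenvalue at least `𝒫(k, λ_i)`. The masses `β m` passed on are those
obtained by peeling a path with `i` vertices one vertex at a time; their subadditivity shows that a
branching tree of pieces is no worse than a path (`exists_isMassSequence`). If the tree cannot be
cut into equal pieces, vertices are left over and zeros suffice
(`IsRootedPiece.exists_potentialCut_or_zeroCut`).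

For equality, the first bound is below `1` when `k ≥ 2`, so it is strict. When `k = 1`, counting
leaves a single interior vertex, which forces a star. -/

namespace SteklovGraph

/-! ### Spectral theorem and min-max principle for symmetric operators -/

/-- A symmetric operator on `ι → ℝ` has an orthonormal basis of eigenvectors. -/
theorem exists_eigenbasis {ι : Type*} [Fintype ι] (T : Module.End ℝ (ι → ℝ))
    (hT : ∀ f g, ∑ x, T f x * g x = ∑ x, f x * T g x) :
    ∃ (μ : ι → ℝ) (b : OrthonormalBasis ι ℝ (EuclideanSpace ℝ ι)),
      (∀ j, T (b j).ofLp = μ j • (b j).ofLp) ∧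
        T.charpoly.roots = Multiset.map μ Finset.univ.val := by
  classical
  have hA : (LinearMap.toMatrix' T).IsHermitian := by
    ext x y
    have h := hT (Pi.single x 1) (Pi.single y 1)
    simpa [LinearMap.toMatrix'_apply, Pi.single_apply, eq_comm] using h
  have h2 : (LinearMap.toMatrix' T).charpoly = T.charpoly :=
    LinearMap.charpoly_toMatrix T (Pi.basisFun ℝ ι)
  refine ⟨hA.eigenvalues, hA.eigenvectorBasis, fun j => ?_, ?_⟩
  · have := hA.mulVec_eigenvectorBasis j
    rwa [LinearMap.toMatrix'_mulVec] at this
  · rw [← h2, hA.roots_charpoly_eq_eigenvalues]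
    rfl

theorem orderedEigenvalue_eq_getElem {ι : Type*} [Fintype ι] (T : Module.End ℝ (ι → ℝ))
    (hT : ∀ f g, ∑ x, T f x * g x = ∑ x, f x * T g x) (i : ℕ) (hi : 1 ≤ i)
    (hi2 : i ≤ Fintype.card ι) :
    ∃ h : i - 1 < (T.charpoly.roots.sort (· ≤ ·)).length,
      orderedEigenvalue T i = (T.charpoly.roots.sort (· ≤ ·))[i - 1] := by
  have h : i - 1 < (T.charpoly.roots.sort (· ≤ ·)).length := by
    rw [Multiset.length_sort, card_roots_charpoly_of_symmetric T hT]
    omega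
  refine ⟨h, ?_⟩
  rw [orderedEigenvalue, List.getD_eq_getElem _ _ h]

/-- Each `orderedEigenvalue` of a symmetric operator is an eigenvalue. -/
theorem exists_eigenvector_orderedEigenvalue {ι : Type*} [Fintype ι] (T : Module.End ℝ (ι → ℝ))
    (hT : ∀ f g, ∑ x, T f x * g x = ∑ x, f x * T g x) (i : ℕ) (hi : 1 ≤ i)
    (hi2 : i ≤ Fintype.card ι) :
    ∃ f : ι → ℝ, f ≠ 0 ∧ T f = orderedEigenvalue T i • f := by
  obtain ⟨h, he⟩ := orderedEigenvalue_eq_getElem T hT i hi hi2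
  have hmem : orderedEigenvalue T i ∈ T.charpoly.roots := by
    rw [he, ← Multiset.mem_sort (r := (· ≤ ·))]
    exact List.getElem_mem h
  have hr := Polynomial.isRoot_of_mem_roots hmem
  rw [← Module.End.hasEigenvalue_iff_isRoot_charpoly] at hr
  obtain ⟨f, hf⟩ := hr.exists_hasEigenvector
  exact ⟨f, hf.2, hf.apply_eq_smul⟩

theorem eigenbasis_expansion {ι : Type*} [Fintype ι] (T : Module.End ℝ (ι → ℝ)) (μ : ι → ℝ)
    (b : OrthonormalBasis ι ℝ (EuclideanSpace ℝ ι))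
    (hb : ∀ j, T (b j).ofLp = μ j • (b j).ofLp) (c : ι → ℝ) (f : ι → ℝ)
    (hf : f = ∑ j, c j • (b j).ofLp) :
    ∑ x, f x * f x = ∑ j, c j * c j ∧ ∑ x, T f x * f x = ∑ j, μ j * (c j * c j) := by
  have hinner : ∀ p q : ι → ℝ, ∑ x, (∑ j, p j • (b j).ofLp) x * (∑ j, q j • (b j).ofLp) x =
      ∑ j, p j * q j := by
    intro p q
    have h1 := b.sum_inner_mul_inner (∑ j, p j • b j) (∑ j, q j • b j)
    have h2 : ∀ (r : ι → ℝ) (j : ι), inner ℝ (b j) (∑ k, r k • b k) = r j := fun r j =>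
      b.orthonormal.inner_right_fintype r j
    have h3 : ∀ (r : ι → ℝ) (j : ι), inner ℝ (∑ k, r k • b k) (b j) = r j := fun r j => by
      rw [real_inner_comm, h2]
    simp only [h2, h3] at h1
    rw [h1, PiLp.inner_apply]
    refine Finset.sum_congr rfl fun x _ => ?_
    simp [mul_comm]
  have hTf : T f = ∑ j, (μ j * c j) • (b j).ofLp := by
    rw [hf, map_sum]
    refine Finset.sum_congr rfl fun j _ => ?_
    rw [map_smul, hb, smul_smul, mul_comm]
  constructor
  · rw [hf, hinner]
  · rw [hTf, hf, hinner]
    exact Finset.sum_congr rfl fun j _ => by ring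

/-- The first eigenvalue bounds the quadratic form from below. -/
theorem orderedEigenvalue_one_mul_le {ι : Type*} [Fintype ι] (T : Module.End ℝ (ι → ℝ))
    (hT : ∀ f g, ∑ x, T f x * g x = ∑ x, f x * T g x) (f : ι → ℝ) :
    orderedEigenvalue T 1 * ∑ x, f x * f x ≤ ∑ x, T f x * f x := by
  classical
  rcases isEmpty_or_nonempty ι with hι | hι
  · simp
  obtain ⟨μ, b, hb, hroots⟩ := exists_eigenbasis T hT
  obtain ⟨h, he⟩ := orderedEigenvalue_eq_getElem T hT 1 le_rfl Fintype.card_pos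
  have hmin : ∀ j, orderedEigenvalue T 1 ≤ μ j := by
    intro j
    have hj : μ j ∈ T.charpoly.roots.sort (· ≤ ·) := by
      rw [Multiset.mem_sort, hroots]
      exact Multiset.mem_map_of_mem μ (Finset.mem_univ j)
    obtain ⟨n, hn, hnj⟩ := List.getElem_of_mem hj
    rw [he, ← hnj]
    rcases Nat.eq_zero_or_pos n with rfl | h0
    · exact le_rfl
    · exact List.pairwise_iff_getElem.1 (Multiset.pairwise_sort T.charpoly.roots (· ≤ ·)) _ _ h hn h0
  have hf : f = ∑ j, (b.repr (WithLp.toLp 2 f) j) • (b j).ofLp := by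
    have := b.sum_repr (WithLp.toLp 2 f)
    have := congrArg WithLp.ofLp this
    simpa using this.symm
  obtain ⟨h1, h2⟩ := eigenbasis_expansion T μ b hb _ f hf
  rw [h1, h2, Finset.mul_sum]
  exact Finset.sum_le_sum fun j _ => mul_le_mul_of_nonneg_right (hmin j) (mul_self_nonneg _)

/-- Min-max principle: fewer than `i` linear constraints admit a nonzero vector whose Rayleigh
quotient is at most the `i`-th eigenvalue. -/
theorem exists_rayleigh_le_orderedEigenvalue {ι : Type*} [Fintype ι] (T : Module.End ℝ (ι → ℝ))
    (hT : ∀ f g, ∑ x, T f x * g x = ∑ x, f x * T g x) (i : ℕ)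
    (hi2 : i ≤ Fintype.card ι) (m : ℕ) (hm : m < i) (A : (ι → ℝ) →ₗ[ℝ] (Fin m → ℝ)) :
    ∃ f : ι → ℝ, f ≠ 0 ∧ A f = 0 ∧
      ∑ x, T f x * f x ≤ orderedEigenvalue T i * ∑ x, f x * f x := by
  classical
  obtain ⟨μ, b, hb, hroots⟩ := exists_eigenbasis T hT
  obtain ⟨h, he⟩ := orderedEigenvalue_eq_getElem T hT i (by omega) hi2
  set σ := orderedEigenvalue T i with hσ
  -- The first `i` entries of the sorted spectrum are at most the `i`-th, so at least `i` basis
  -- eigenvectors have eigenvalue at most `σ`; their span meets the kernel of fewer than `i`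
  -- functionals.
  have hcard : i ≤ Fintype.card {j // μ j ≤ σ} := by
    have h1 : Fintype.card {j // μ j ≤ σ} =
        List.countP (fun x => decide (x ≤ σ)) (T.charpoly.roots.sort (· ≤ ·)) := by
      rw [← Multiset.coe_countP, Multiset.sort_eq, hroots, Multiset.countP_map, Fintype.card_subtype]
      rfl
    rw [h1]
    have h2 : List.countP (fun x => decide (x ≤ σ)) ((T.charpoly.roots.sort (· ≤ ·)).take i) = i := by
      rw [List.countP_eq_length.2]
      · rw [List.length_take]
        omega
      · intro a ha
        obtain ⟨n, hn, hna⟩ := List.getElem_of_mem ha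
        rw [List.getElem_take] at hna
        rw [List.length_take] at hn
        rw [decide_eq_true_eq, he, ← hna]
        rcases Nat.lt_or_ge n (i - 1) with h0 | h0
        · exact List.pairwise_iff_getElem.1
            (Multiset.pairwise_sort T.charpoly.roots (· ≤ ·)) _ _ _ h h0
        · have : n = i - 1 := by omega
          subst this
          exact le_rfl
    calc i = _ := h2.symm
      _ ≤ _ := (List.take_sublist _ _).countP_le
  let F : ({j // μ j ≤ σ} → ℝ) →ₗ[ℝ] (ι → ℝ) :=
    Fintype.linearCombination ℝ (fun j : {j // μ j ≤ σ} => (b j.1).ofLp)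
  have hker : LinearMap.ker (A ∘ₗ F) ≠ ⊥ := by
    apply LinearMap.ker_ne_bot_of_finrank_lt
    simp only [Module.finrank_fintype_fun_eq_card, Fintype.card_fin]
    omega
  obtain ⟨c, hc, hc0⟩ := Submodule.exists_mem_ne_zero_of_ne_bot hker
  let d : ι → ℝ := fun j => if hj : μ j ≤ σ then c ⟨j, hj⟩ else 0
  have hF : F c = ∑ j, d j • (b j).ofLp := by
    simp only [F, Fintype.linearCombination_apply]
    refine Finset.sum_of_injOn Subtype.val Subtype.val_injective.injOn (by simp) ?_ ?_
    · intro j _ hj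
      have : ¬ μ j ≤ σ := fun h => hj ⟨⟨j, h⟩, by simp, rfl⟩
      simp [d, this]
    · intro j _
      simp [d, j.2]
  obtain ⟨h1, h2⟩ := eigenbasis_expansion T μ b hb d _ hF
  refine ⟨F c, ?_, hc, ?_⟩
  · intro h0
    rw [h0] at h1
    have h3 : ∑ j, d j * d j = 0 := by simpa using h1.symm
    rw [Finset.sum_eq_zero_iff_of_nonneg fun j _ => mul_self_nonneg _] at h3
    apply hc0
    funext j
    have := mul_self_eq_zero.1 (h3 j.1 (Finset.mem_univ _))
    simpa [d, j.2] using this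
  · rw [h1, h2, Finset.mul_sum]
    refine Finset.sum_le_sum fun j _ => ?_
    by_cases hj : μ j ≤ σ
    · exact mul_le_mul_of_nonneg_right hj (mul_self_nonneg _)
    · simp [d, hj]

/-! ### Rearrangement and Faber-Krahn inequalities -/

/-- `e` bounds the sum of the squared gaps between the sorted values of `v` on `C`, where the values
are listed by a monotone sequence `a` along a ranking `ρ`. -/
def DominatesGaps {V : Type*} (C : Finset V) (v : V → ℝ) (e : ℝ) : Prop :=
  ∀ (ρ : V → ℕ) (a : ℕ → ℝ), Monotone a → (∀ x ∈ C, v x = a (ρ x)) →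
    ∀ x ∈ C, ∀ y ∈ C, ∑ j ∈ Finset.Ico (ρ x) (ρ y), (a (j + 1) - a j) ^ 2 ≤ e

/-- The gaps are nonnegative, so the sum of their squares is at most the square of their sum. -/
theorem sum_sq_gap_le (a : ℕ → ℝ) (ha : Monotone a) (p q : ℕ) :
    ∑ j ∈ Finset.Ico p q, (a (j + 1) - a j) ^ 2 ≤ (a q - a p) ^ 2 := by
  rcases le_total q p with h | h
  · rw [Finset.Ico_eq_empty_of_le h, Finset.sum_empty]
    positivity
  · induction q, h using Nat.le_induction with
    | base => simp
    | succ q hpq ih =>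
      rw [Finset.sum_Ico_succ_top hpq]
      have h1 := ha hpq
      have h2 := ha (Nat.le_succ q)
      nlinarith [mul_nonneg (sub_nonneg.2 h1) (sub_nonneg.2 h2)]

/-- No order of `p`, `q`, `r` is assumed: in every case the first interval is covered by the other
two. -/
theorem sum_sq_gap_triangle (a : ℕ → ℝ) (p q r : ℕ) :
    ∑ j ∈ Finset.Ico p r, (a (j + 1) - a j) ^ 2 ≤
      ∑ j ∈ Finset.Ico p q, (a (j + 1) - a j) ^ 2 +
        ∑ j ∈ Finset.Ico q r, (a (j + 1) - a j) ^ 2 := by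
  rw [← Finset.sum_union (Finset.Ico_disjoint_Ico_consecutive p q r)]
  refine Finset.sum_le_sum_of_subset_of_nonneg ?_ fun _ _ _ => sq_nonneg _
  intro j
  simp only [Finset.mem_Ico, Finset.mem_union]
  omega

theorem dominatesGaps_singleton {V : Type*} (r : V) (v : V → ℝ) : DominatesGaps {r} v 0 := by
  intro ρ a _ _ x hx y hy
  rw [Finset.mem_singleton] at hx hy
  simp [hx, hy]

/-- A path from one piece to the other passes through the edge `r₁r₂`. The gaps between `x` and `y`
are covered by those from `x` to `r₁`, across the edge, and from `r₂` to `y`, each paid for by its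
own energy. -/
theorem DominatesGaps.union {V : Type*} [DecidableEq V] {C₁ C₂ : Finset V} {v : V → ℝ}
    {e₁ e₂ e : ℝ} (h₁ : DominatesGaps C₁ v e₁) (h₂ : DominatesGaps C₂ v e₂) {r₁ r₂ : V}
    (hr₁ : r₁ ∈ C₁) (hr₂ : r₂ ∈ C₂) (h : (v r₁ - v r₂) ^ 2 ≤ e) :
    DominatesGaps (C₁ ∪ C₂) v (e₁ + e₂ + e) := by
  intro ρ a ha hv
  have hv₁ : ∀ x ∈ C₁, v x = a (ρ x) := fun x hx => hv x (Finset.mem_union_left _ hx)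
  have hv₂ : ∀ x ∈ C₂, v x = a (ρ x) := fun x hx => hv x (Finset.mem_union_right _ hx)
  have k₁ := h₁ ρ a ha hv₁
  have k₂ := h₂ ρ a ha hv₂
  rw [hv₁ r₁ hr₁, hv₂ r₂ hr₂] at h
  -- The empty interval shows that `e₁` is nonnegative.
  have n₁ := k₁ r₁ hr₁ r₁ hr₁
  have n₂ := k₂ r₂ hr₂ r₂ hr₂
  simp only [Finset.Ico_self, Finset.sum_empty] at n₁ n₂
  have n : 0 ≤ e := (sq_nonneg _).trans h
  have g₁ := (sum_sq_gap_le a ha (ρ r₁) (ρ r₂)).trans ((sub_sq_comm _ _).le.trans h)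
  have g₂ := (sum_sq_gap_le a ha (ρ r₂) (ρ r₁)).trans h
  intro x hx y hy
  rcases Finset.mem_union.1 hx with hx | hx <;> rcases Finset.mem_union.1 hy with hy | hy
  · linarith [k₁ x hx y hy]
  · linarith [sum_sq_gap_triangle a (ρ x) (ρ r₁) (ρ y), sum_sq_gap_triangle a (ρ r₁) (ρ r₂) (ρ y),
      k₁ x hx r₁ hr₁, k₂ r₂ hr₂ y hy]
  · linarith [sum_sq_gap_triangle a (ρ x) (ρ r₂) (ρ y), sum_sq_gap_triangle a (ρ r₂) (ρ r₁) (ρ y),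
      k₂ x hx r₂ hr₂, k₁ r₁ hr₁ y hy]
  · linarith [k₂ x hx y hy]

/-- The values of `v ≥ 0` on `N` can be sorted into the positions `K - |N| + 1, …, K`. -/
theorem exists_ranking {V : Type*} [DecidableEq V] (v : V → ℝ) (N : Finset V) :
    (∀ x ∈ N, 0 ≤ v x) → ∀ K, N.card ≤ K → ∃ (ρ : V → ℕ) (a : ℕ → ℝ), Monotone a ∧ a 0 = 0 ∧
      (∀ x ∈ N, v x = a (ρ x)) ∧ ∑ x ∈ N, v x ^ 2 = ∑ j ∈ Finset.range K, a (j + 1) ^ 2 ∧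
      (∀ j, K - N.card < j → j ≤ K → ∃ x ∈ N, ρ x = j) ∧
      (∀ x ∈ N, K - N.card < ρ x ∧ ρ x ≤ K) ∧
      (∀ M, 0 ≤ M → (∀ x ∈ N, v x ≤ M) → ∀ j, a j ≤ M) := by
  induction hn : N.card generalizing N with
  | zero =>
    rw [Finset.card_eq_zero] at hn
    subst hn
    intro _ K _
    refine ⟨fun _ => 0, fun _ => 0, monotone_const, rfl, by simp, by simp, ?_, by simp, ?_⟩
    · intro j h1 h2
      omega
    · intro M hM _ _
      exact hM
  | succ n ih =>
    intro hv K hK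
    have hne : N.Nonempty := Finset.card_pos.1 (by omega)
    -- The largest value takes the last position and the rest are sorted inductively. The final
    -- clause of the statement keeps the sequence monotone at this step; unused low positions carry
    -- the value `0`.
    obtain ⟨y, hy, hmax⟩ := N.exists_max_image v hne
    obtain ⟨K, rfl⟩ : ∃ K', K = K' + 1 := ⟨K - 1, by omega⟩
    obtain ⟨ρ, a, ha, ha0, hρ, hsum, hsurj, hgt, hbd⟩ :=
      ih (N.erase y) (by rw [Finset.card_erase_of_mem hy, hn]; rfl)
        (fun x hx => hv x (Finset.mem_of_mem_erase hx)) K (by omega)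
    have hay : ∀ j, a j ≤ v y := hbd (v y) (hv y hy) fun x hx => hmax x (Finset.mem_of_mem_erase hx)
    have hy0 := hv y hy
    have key : ∀ x ∈ N, x ≠ y → ρ x ≤ K ∧ K - n < ρ x ∧ v x = a (ρ x) := fun x hx hxy =>
      have hx' := Finset.mem_erase.2 ⟨hxy, hx⟩
      ⟨(hgt x hx').2, (hgt x hx').1, hρ x hx'⟩
    refine ⟨fun x => if x = y then K + 1 else ρ x, fun j => if j ≤ K then a j else v y,
      ?_, ?_, ?_, ?_, ?_, ?_, ?_⟩
    · intro p q hpq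
      by_cases hq : q ≤ K
      · simpa [hq, hpq.trans hq] using ha hpq
      · by_cases hp : p ≤ K
        · simpa [hp, hq] using hay p
        · simp [hp, hq]
    · simpa using ha0
    · intro x hx
      by_cases hxy : x = y
      · simp [hxy]
      · simpa [hxy, (key x hx hxy).1] using (key x hx hxy).2.2
    · rw [← Finset.add_sum_erase N _ hy, hsum, Finset.sum_range_succ, add_comm]
      congr 1
      · refine Finset.sum_congr rfl fun j hj => ?_
        rw [Finset.mem_range] at hj
        simp [Nat.succ_le_of_lt hj]
      · simp
    · intro j h1 h2
      by_cases hj : j = K + 1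
      · exact ⟨y, hy, by simp [hj]⟩
      · obtain ⟨x, hx, hxj⟩ := hsurj j (by omega) (by omega)
        exact ⟨x, Finset.mem_of_mem_erase hx, by simpa [Finset.ne_of_mem_erase hx] using hxj⟩
    · intro x hx
      by_cases hxy : x = y
      · simp only [hxy, if_true]
        omega
      · have := key x hx hxy
        simp only [hxy, if_false]
        omega
    · intro M hM hNM j
      dsimp only
      split_ifs
      · exact hbd M hM (fun x hx => hNM x (Finset.mem_of_mem_erase hx)) j
      · exact hNM y hy

/-- Faber-Krahn inequality for a piece on which `v` has a zero and at most `K` nonzero values. -/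
theorem DominatesGaps.mul_sum_sq_le_of_zero {V : Type*} [DecidableEq V] {C : Finset V} {v : V → ℝ}
    {e c : ℝ} {K : ℕ} (h : DominatesGaps C v e) (hv : ∀ x, 0 ≤ v x) {Z : Finset V}
    (hZ : ∀ z ∈ Z, v z = 0) (hCZ : (C ∩ Z).Nonempty) (hK : (C \ Z).card ≤ K)
    (hc : ∀ a : ℕ → ℝ, a 0 = 0 →
      c * ∑ j ∈ Finset.range K, a (j + 1) ^ 2 ≤ ∑ j ∈ Finset.range K, (a (j + 1) - a j) ^ 2) :
    c * ∑ x ∈ C, v x ^ 2 ≤ e := by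
  obtain ⟨ρ, a, ha, ha0, hρ, hsum, hsurj, hgt, -⟩ :=
    exists_ranking v (C \ Z) (fun x _ => hv x) K hK
  obtain ⟨z, hz⟩ := hCZ
  rw [Finset.mem_inter] at hz
  have hCsum : ∑ x ∈ C, v x ^ 2 = ∑ x ∈ C \ Z, v x ^ 2 := by
    refine (Finset.sum_subset Finset.sdiff_subset fun x hx hx' => ?_).symm
    have : x ∈ Z := by
      by_contra hxZ
      exact hx' (Finset.mem_sdiff.2 ⟨hx, hxZ⟩)
    rw [hZ x this]
    norm_num
  -- All zeros share rank `0`, so the gaps from a zero to the vertex of rank `K` run over the whole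
  -- Dirichlet path.
  have hr : ∀ x ∈ C, v x = a ((fun x => if x ∈ Z then 0 else ρ x) x) := by
    intro x hx
    by_cases hxZ : x ∈ Z
    · simp [hxZ, ha0, hZ x hxZ]
    · simpa [hxZ] using hρ x (Finset.mem_sdiff.2 ⟨hx, hxZ⟩)
  have hk := h _ a ha hr z hz.1
  rcases Finset.eq_empty_or_nonempty (C \ Z) with hN | hN
  · rw [hCsum, hN]
    simpa using hk z hz.1
  · have hpos := Finset.card_pos.2 hN
    obtain ⟨y, hy, hyK⟩ := hsurj K (by omega) le_rfl
    rw [Finset.mem_sdiff] at hy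
    have := hk y hy.1
    simp only [hz.2, hy.2, if_true, if_false, hyK, Nat.Ico_zero_eq_range] at this
    rw [hCsum, hsum]
    exact (hc a ha0).trans this

/-- Faber-Krahn inequality for a piece of `k` vertices with a potential of total mass `≥ lam`. -/
theorem DominatesGaps.mul_sum_sq_le_of_potential {V : Type*} [DecidableEq V] {C : Finset V}
    {v : V → ℝ} {e c lam : ℝ} {k : ℕ} (h : DominatesGaps C v e) (hv : ∀ x, 0 ≤ v x)
    (hk : C.card = k) (hk1 : 1 ≤ k) {q : V → ℝ} (hq : ∀ x, 0 ≤ q x) (hlam : lam ≤ ∑ x ∈ C, q x)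
    (hc : ∀ a : ℕ → ℝ, c * ∑ j ∈ Finset.range k, a (j + 1) ^ 2 ≤
      lam * a 1 ^ 2 + ∑ j ∈ Finset.Ico 1 k, (a (j + 1) - a j) ^ 2) :
    c * ∑ x ∈ C, v x ^ 2 ≤ e + ∑ x ∈ C, q x * v x ^ 2 := by
  obtain ⟨ρ, a, ha, ha0, hρ, hsum, hsurj, hgt, -⟩ :=
    exists_ranking v C (fun x _ => hv x) k hk.le
  obtain ⟨x, hx, hx1⟩ := hsurj 1 (by omega) hk1
  obtain ⟨y, hy, hyk⟩ := hsurj k (by omega) le_rfl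
  have h1 := h ρ a ha hρ x hx y hy
  rw [hx1, hyk] at h1
  -- Since `a 1` is the smallest value on `C`, moving the whole potential to that position can only
  -- decrease its contribution.
  have h2 : lam * a 1 ^ 2 ≤ ∑ x ∈ C, q x * v x ^ 2 := by
    refine (mul_le_mul_of_nonneg_right hlam (sq_nonneg _)).trans ?_
    rw [Finset.sum_mul]
    refine Finset.sum_le_sum fun z hz => mul_le_mul_of_nonneg_left ?_ (hq z)
    have h01 : 0 ≤ a 1 := ha0 ▸ ha (Nat.zero_le 1)
    rw [hρ z hz]
    exact pow_le_pow_left₀ h01 (ha (by have := (hgt z hz).1; omega)) 2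
  rw [hsum]
  linarith [hc a]

/-! ### Spanning trees grown by grafting, and their energy -/

/-- `IsRootedPiece G T r`: `T` is grown from single vertices by repeatedly joining a piece with root
`r₂` to a piece with root `r₁` along an edge `r₁r₂`. -/
inductive IsRootedPiece {V : Type*} [DecidableEq V] (G : SimpleGraph V) : Finset V → V → Prop
  | single (r : V) : IsRootedPiece G {r} r
  | graft {T₁ T₂ : Finset V} {r₁ r₂ : V} : IsRootedPiece G T₁ r₁ → IsRootedPiece G T₂ r₂ →
      Disjoint T₁ T₂ → G.Adj r₁ r₂ → IsRootedPiece G (T₁ ∪ T₂) r₁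

theorem IsRootedPiece.root_mem {V : Type*} [DecidableEq V] {G : SimpleGraph V} {T : Finset V} {r : V}
    (h : IsRootedPiece G T r) : r ∈ T := by
  induction h with
  | single r => simp
  | graft _ _ _ _ ih _ => exact Finset.mem_union_left _ ih

theorem IsRootedPiece.insert {V : Type*} [DecidableEq V] {G : SimpleGraph V} {T : Finset V} {r : V}
    (h : IsRootedPiece G T r) {x y : V} (hx : x ∈ T) (hy : y ∉ T) (hxy : G.Adj x y) :
    IsRootedPiece G (insert y T) r := by
  induction h with
  | single r =>
    rw [Finset.mem_singleton] at hx
    subst hx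
    have := IsRootedPiece.graft (.single x) (.single y)
      (Finset.disjoint_singleton.2 hxy.ne) hxy
    rwa [Finset.union_comm] at this
  | @graft T₁ T₂ r₁ r₂ h₁ h₂ hd hr ih₁ ih₂ =>
    rw [Finset.mem_union, not_or] at hy
    rcases Finset.mem_union.1 hx with hx | hx
    · rw [← Finset.insert_union]
      exact .graft (ih₁ hx hy.1) h₂ (Finset.disjoint_insert_left.2 ⟨hy.2, hd⟩) hr
    · rw [← Finset.union_insert]
      exact .graft h₁ (ih₂ hx hy.2) (Finset.disjoint_insert_right.2 ⟨hy.1, hd⟩) hr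

/-- A rooted piece of maximal size is closed under adjacency, as a neighbour outside it could be
attached as a leaf; connectivity does the rest. -/
theorem isRootedPiece_univ {V : Type*} [Fintype V] [DecidableEq V] {G : SimpleGraph V}
    (hG : G.Connected) (r : V) : IsRootedPiece G Finset.univ r := by
  classical
  obtain ⟨T, hT, hmax⟩ := (Finset.univ.filter fun T : Finset V => IsRootedPiece G T r).exists_max_image
    Finset.card ⟨{r}, by simpa using IsRootedPiece.single r⟩
  rw [Finset.mem_filter] at hT
  have hcl : ∀ x y, G.Adj x y → x ∈ T → y ∈ T := by
    intro x y hxy hx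
    by_contra hy
    have := hmax (insert y T) (Finset.mem_filter.2 ⟨Finset.mem_univ _, hT.2.insert hx hy hxy⟩)
    rw [Finset.card_insert_of_notMem hy] at this
    omega
  have : T = Finset.univ := by
    rw [Finset.eq_univ_iff_forall]
    intro x
    obtain ⟨p⟩ := hG.preconnected r x
    have key : ∀ a b, G.Walk a b → a ∈ T → b ∈ T := by
      intro a b p
      induction p with
      | nil => exact id
      | cons h _ ih => exact fun ha => ih (hcl _ _ h ha)
    exact key r x p hT.2.root_mem
  exact this ▸ hT.2

/-- The Dirichlet energy of `u` on the subgraph induced by `T`. -/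
noncomputable def energyOn {V : Type*} (G : SimpleGraph V) (T : Finset V) (u : V → ℝ) : ℝ :=
  1 / 2 * ∑ x ∈ T, ∑ y ∈ T, unitWeight G x y * (u y - u x) ^ 2

theorem unitWeight_nonneg {V : Type*} (G : SimpleGraph V) (x y : V) : 0 ≤ unitWeight G x y := by
  unfold unitWeight
  split_ifs <;> norm_num

theorem unitWeight_comm {V : Type*} (G : SimpleGraph V) (x y : V) :
    unitWeight G x y = unitWeight G y x := by
  by_cases h : G.Adj x y
  · simp [unitWeight, h, h.symm]
  · simp [unitWeight, h, mt SimpleGraph.Adj.symm h]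

/-- All cross edges except `r₁r₂` are dropped. That edge occurs in both orientations, which the
factor `1 / 2` compensates. -/
theorem energyOn_union {V : Type*} [DecidableEq V] {G : SimpleGraph V} {T₁ T₂ : Finset V}
    (hd : Disjoint T₁ T₂) {r₁ r₂ : V} (h₁ : r₁ ∈ T₁) (h₂ : r₂ ∈ T₂) (hr : G.Adj r₁ r₂) (u : V → ℝ) :
    energyOn G T₁ u + energyOn G T₂ u + (u r₁ - u r₂) ^ 2 ≤ energyOn G (T₁ ∪ T₂) u := by
  have hn : ∀ x y, 0 ≤ unitWeight G x y * (u y - u x) ^ 2 := fun x y =>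
    mul_nonneg (unitWeight_nonneg G x y) (sq_nonneg _)
  have h12 : (u r₁ - u r₂) ^ 2 ≤ ∑ x ∈ T₁, ∑ y ∈ T₂, unitWeight G x y * (u y - u x) ^ 2 := by
    refine le_trans ?_ (Finset.single_le_sum (fun x _ => Finset.sum_nonneg fun y _ => hn x y) h₁)
    refine le_trans (le_of_eq ?_) (Finset.single_le_sum (fun y _ => hn r₁ y) h₂)
    rw [unitWeight, if_pos hr]
    ring
  have h21 : (u r₁ - u r₂) ^ 2 ≤ ∑ x ∈ T₂, ∑ y ∈ T₁, unitWeight G x y * (u y - u x) ^ 2 := by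
    refine le_trans ?_ (Finset.single_le_sum (fun x _ => Finset.sum_nonneg fun y _ => hn x y) h₂)
    refine le_trans (le_of_eq ?_) (Finset.single_le_sum (fun y _ => hn r₂ y) h₁)
    rw [unitWeight, if_pos hr.symm]
    ring
  simp only [energyOn, Finset.sum_union hd, Finset.sum_add_distrib]
  linarith

/-! ### Cutting at zeros -/

/-- A choice of `m` linear constraints that make `u` vanish on a set `Z` of vertices, such that off
an open connected part `C` containing the root `r`, with at most `s` vertices outside `Z`, the energy
is at least `c ∑ u²`. -/
def ZeroCut {V : Type*} [DecidableEq V] (G : SimpleGraph V) (c : ℝ) (T : Finset V) (r : V)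
    (m s : ℕ) : Prop :=
  ∃ (l : List (Module.Dual ℝ (V → ℝ))) (C Z : Finset V), l.length = m ∧ r ∈ C ∧ C ⊆ T ∧
    (C \ Z).card ≤ s ∧ (m = 0 ∨ (C ∩ Z).Nonempty) ∧ ∀ u : V → ℝ, (∀ φ ∈ l, φ u = 0) →
      (∀ z ∈ Z, u z = 0) ∧ ∃ e, DominatesGaps C (fun x => |u x|) e ∧
        e + c * ∑ x ∈ T \ C, u x ^ 2 ≤ energyOn G T u

theorem sq_abs_sub_abs_le (a b : ℝ) : (|a| - |b|) ^ 2 ≤ (a - b) ^ 2 :=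
  sq_le_sq.2 (abs_abs_sub_abs_le a b)

theorem zeroCut_singleton {V : Type*} [DecidableEq V] (G : SimpleGraph V) (c : ℝ) (r : V) :
    ZeroCut G c {r} r 0 1 := by
  refine ⟨[], {r}, ∅, rfl, by simp, subset_rfl, by simp, Or.inl rfl, fun u _ => ⟨by simp, 0,
    dominatesGaps_singleton _ _, ?_⟩⟩
  simp [energyOn]

theorem sum_union_sdiff_union {V : Type*} [DecidableEq V] {T₁ T₂ C₁ C₂ : Finset V}
    (hd : Disjoint T₁ T₂) (h₁ : C₁ ⊆ T₁) (h₂ : C₂ ⊆ T₂) (f : V → ℝ) :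
    ∑ x ∈ (T₁ ∪ T₂) \ (C₁ ∪ C₂), f x = ∑ x ∈ T₁ \ C₁, f x + ∑ x ∈ T₂ \ C₂, f x := by
  rw [← Finset.sum_union (hd.mono Finset.sdiff_subset Finset.sdiff_subset)]
  congr 1
  ext x
  have h0 : x ∈ T₁ → x ∉ T₂ := fun h => Finset.disjoint_left.1 hd h
  have h1 : x ∈ C₁ → x ∈ T₁ := fun h => h₁ h
  have h2 : x ∈ C₂ → x ∈ T₂ := fun h => h₂ h
  simp only [Finset.mem_sdiff, Finset.mem_union]
  tauto

theorem sum_union_sdiff {V : Type*} [DecidableEq V] {T₁ T₂ C₁ : Finset V}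
    (hd : Disjoint T₁ T₂) (h₁ : C₁ ⊆ T₁) (f : V → ℝ) :
    ∑ x ∈ (T₁ ∪ T₂) \ C₁, f x = ∑ x ∈ T₁ \ C₁, f x + ∑ x ∈ T₂, f x := by
  simpa using sum_union_sdiff_union hd h₁ (Finset.empty_subset T₂) f

/-- The two open parts are joined through the edge `r₁r₂`; no new constraint is spent. -/
theorem ZeroCut.merge {V : Type*} [DecidableEq V] {G : SimpleGraph V} {c : ℝ} {T₁ T₂ : Finset V}
    {r₁ r₂ : V} {m₁ m₂ s₁ s₂ : ℕ} (h₁ : ZeroCut G c T₁ r₁ m₁ s₁) (h₂ : ZeroCut G c T₂ r₂ m₂ s₂)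
    (hd : Disjoint T₁ T₂) (hr : G.Adj r₁ r₂) :
    ZeroCut G c (T₁ ∪ T₂) r₁ (m₁ + m₂) (s₁ + s₂) := by
  obtain ⟨l₁, C₁, Z₁, hl₁, hr₁, hC₁, hs₁, hm₁, H₁⟩ := h₁
  obtain ⟨l₂, C₂, Z₂, hl₂, hr₂, hC₂, hs₂, hm₂, H₂⟩ := h₂
  refine ⟨l₁ ++ l₂, C₁ ∪ C₂, Z₁ ∪ Z₂, by simp [hl₁, hl₂], Finset.mem_union_left _ hr₁,
    Finset.union_subset_union hC₁ hC₂, ?_, ?_, ?_⟩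
  · refine (Finset.card_le_card ?_).trans ((Finset.card_union_le (C₁ \ Z₁) (C₂ \ Z₂)).trans
      (add_le_add hs₁ hs₂))
    intro x
    simp only [Finset.mem_sdiff, Finset.mem_union]
    tauto
  · have e₁ : C₁ ∩ Z₁ ⊆ (C₁ ∪ C₂) ∩ (Z₁ ∪ Z₂) :=
      Finset.inter_subset_inter Finset.subset_union_left Finset.subset_union_left
    have e₂ : C₂ ∩ Z₂ ⊆ (C₁ ∪ C₂) ∩ (Z₁ ∪ Z₂) :=
      Finset.inter_subset_inter Finset.subset_union_right Finset.subset_union_right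
    rcases hm₁ with rfl | h
    · rcases hm₂ with rfl | h
      · exact Or.inl rfl
      · exact Or.inr (h.mono e₂)
    · exact Or.inr (h.mono e₁)
  · intro u hu
    obtain ⟨hz₁, e₁, hg₁, he₁⟩ := H₁ u fun φ hφ => hu φ (List.mem_append_left _ hφ)
    obtain ⟨hz₂, e₂, hg₂, he₂⟩ := H₂ u fun φ hφ => hu φ (List.mem_append_right _ hφ)
    refine ⟨fun z hz => (Finset.mem_union.1 hz).elim (hz₁ z) (hz₂ z), e₁ + e₂ + (u r₁ - u r₂) ^ 2,
      hg₁.union hg₂ hr₁ hr₂ (sq_abs_sub_abs_le _ _), ?_⟩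
    rw [sum_union_sdiff_union hd hC₁ hC₂]
    linarith [energyOn_union hd (hC₁ hr₁) (hC₂ hr₂) hr u]

/-- Imposing `u r = 0` gives the open part a zero, so Faber-Krahn settles all of it. The new open
part is the root alone, with no vertex outside the zeros. -/
theorem ZeroCut.seal {V : Type*} [DecidableEq V] {G : SimpleGraph V} {c : ℝ} {T : Finset V}
    {r : V} {m s K : ℕ} (h : ZeroCut G c T r m s) (hs : s ≤ K)
    (hc : ∀ a : ℕ → ℝ, a 0 = 0 →
      c * ∑ j ∈ Finset.range K, a (j + 1) ^ 2 ≤ ∑ j ∈ Finset.range K, (a (j + 1) - a j) ^ 2) :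
    ZeroCut G c T r (m + 1) 0 := by
  obtain ⟨l, C, Z, hl, hr, hC, hsC, hm, H⟩ := h
  refine ⟨LinearMap.proj r :: l, {r}, {r}, by simp [hl], by simp,
    Finset.singleton_subset_iff.2 (hC hr), by simp, by simp, fun u hu => ?_⟩
  have hur : u r = 0 := hu _ List.mem_cons_self
  obtain ⟨hz, e, hg, he⟩ := H u fun φ hφ => hu φ (List.mem_cons_of_mem _ hφ)
  refine ⟨by simpa using hur, 0, dominatesGaps_singleton _ _, ?_⟩
  have h1 := hg.mul_sum_sq_le_of_zero (fun x => abs_nonneg _) (Z := insert r Z) (K := K) (c := c)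
    (by
      intro z hz'
      rcases Finset.mem_insert.1 hz' with rfl | h
      · simpa using hur
      · simpa using hz z h)
    ⟨r, by simp [hr]⟩
    ((Finset.card_le_card (Finset.sdiff_subset_sdiff subset_rfl (Finset.subset_insert _ _))).trans
      (hsC.trans hs)) hc
  simp only [sq_abs] at h1
  have h2 : ∑ x ∈ T \ {r}, u x ^ 2 = ∑ x ∈ T \ C, u x ^ 2 + ∑ x ∈ C, u x ^ 2 := by
    rw [Finset.sum_sdiff hC, ← Finset.sum_sdiff (Finset.singleton_subset_iff.2 (hC hr))]
    simp [hur]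
  rw [h2]
  linarith

/-- Here `u r₁ = 0`, and this zero also serves the open part of `T₂` through the edge `r₁r₂`:
Faber-Krahn applies to that part enlarged by `r₁`, without a further constraint. -/
theorem ZeroCut.graft_of_sealed {V : Type*} [DecidableEq V] {G : SimpleGraph V} {c : ℝ}
    {T₁ T₂ : Finset V} {r₁ r₂ : V} {m₁ m₂ s₂ K : ℕ} (h₁ : ZeroCut G c T₁ r₁ m₁ 0)
    (h₂ : ZeroCut G c T₂ r₂ m₂ s₂) (hs : s₂ ≤ K) (hd : Disjoint T₁ T₂) (hr : G.Adj r₁ r₂)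
    (hc : ∀ a : ℕ → ℝ, a 0 = 0 →
      c * ∑ j ∈ Finset.range K, a (j + 1) ^ 2 ≤ ∑ j ∈ Finset.range K, (a (j + 1) - a j) ^ 2) :
    ZeroCut G c (T₁ ∪ T₂) r₁ (m₁ + m₂) 0 := by
  obtain ⟨l₁, C₁, Z₁, hl₁, hr₁, hC₁, hs₁, hm₁, H₁⟩ := h₁
  obtain ⟨l₂, C₂, Z₂, hl₂, hr₂, hC₂, hs₂, hm₂, H₂⟩ := h₂
  have hrZ : r₁ ∈ Z₁ := by
    by_contra h
    have h0 := Finset.card_eq_zero.1 (Nat.le_zero.1 hs₁)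
    exact Finset.notMem_empty r₁ (h0 ▸ Finset.mem_sdiff.2 ⟨hr₁, h⟩)
  refine ⟨l₁ ++ l₂, C₁, Z₁, by simp [hl₁, hl₂], hr₁, hC₁.trans Finset.subset_union_left, hs₁,
    Or.inr ⟨r₁, Finset.mem_inter.2 ⟨hr₁, hrZ⟩⟩, fun u hu => ?_⟩
  obtain ⟨hz₁, e₁, hg₁, he₁⟩ := H₁ u fun φ hφ => hu φ (List.mem_append_left _ hφ)
  obtain ⟨hz₂, e₂, hg₂, he₂⟩ := H₂ u fun φ hφ => hu φ (List.mem_append_right _ hφ)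
  refine ⟨hz₁, e₁, hg₁, ?_⟩
  have hur : u r₁ = 0 := hz₁ r₁ hrZ
  have hg := (dominatesGaps_singleton r₁ fun x => |u x|).union hg₂ (by simp) hr₂
    (sq_abs_sub_abs_le (u r₁) (u r₂))
  have h1 := hg.mul_sum_sq_le_of_zero (fun x => abs_nonneg _) (Z := insert r₁ Z₂) (K := K) (c := c)
    (by
      intro z hz'
      rcases Finset.mem_insert.1 hz' with rfl | h
      · simpa using hur
      · simpa using hz₂ z h)
    ⟨r₁, by simp⟩
    ((Finset.card_le_card (by
      intro x
      simp only [Finset.mem_sdiff, Finset.mem_union, Finset.mem_insert, Finset.mem_singleton]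
      tauto)).trans (hs₂.trans hs)) hc
  simp only [sq_abs] at h1
  have hr₁C₂ : r₁ ∉ C₂ := fun h => Finset.disjoint_left.1 hd (hC₁ hr₁) (hC₂ h)
  rw [Finset.sum_union (Finset.disjoint_singleton_left.2 hr₁C₂), Finset.sum_singleton, hur] at h1
  have h2 := Finset.sum_sdiff (f := fun x => u x ^ 2) hC₂
  rw [sum_union_sdiff hd hC₁, ← h2]
  have h3 := energyOn_union hd (hC₁ hr₁) (hC₂ hr₂) hr u
  rw [hur] at h3
  linarith

/-- Every constraint is charged to `K + 1` vertices. Open parts are merged while they fit into `K`;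
otherwise they hold at least `K + 1` vertices together, which pays for one zero at `r₁` settling
both. -/
theorem IsRootedPiece.exists_zeroCut {V : Type*} [DecidableEq V] {G : SimpleGraph V} {c : ℝ}
    {T : Finset V} {r : V} {K : ℕ} (hK : 1 ≤ K)
    (hc : ∀ a : ℕ → ℝ, a 0 = 0 →
      c * ∑ j ∈ Finset.range K, a (j + 1) ^ 2 ≤ ∑ j ∈ Finset.range K, (a (j + 1) - a j) ^ 2)
    (h : IsRootedPiece G T r) :
    ∃ m s, s ≤ K ∧ m * (K + 1) + s ≤ T.card ∧ ZeroCut G c T r m s := by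
  induction h with
  | single r => exact ⟨0, 1, hK, by simp, zeroCut_singleton G c r⟩
  | graft _ _ hd hr ih₁ ih₂ =>
    obtain ⟨m₁, s₁, hs₁, hn₁, h₁⟩ := ih₁
    obtain ⟨m₂, s₂, hs₂, hn₂, h₂⟩ := ih₂
    rw [Finset.card_union_of_disjoint hd]
    by_cases h : s₁ + s₂ ≤ K
    · exact ⟨_, _, h, by linarith, h₁.merge h₂ hd hr⟩
    · refine ⟨_, _, Nat.zero_le _, ?_, (h₁.seal hs₁ hc).graft_of_sealed h₂ hs₂ hd hr hc⟩
      push Not at h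
      nlinarith

theorem ZeroCut.exists_constraints {V : Type*} [Fintype V] [DecidableEq V] {G : SimpleGraph V}
    {c : ℝ} {r : V} {m s K M : ℕ} (h : ZeroCut G c Finset.univ r m s) (hs : s ≤ K) (hm : m ≤ M)
    (hM : 1 ≤ M)
    (hc : ∀ a : ℕ → ℝ, a 0 = 0 →
      c * ∑ j ∈ Finset.range K, a (j + 1) ^ 2 ≤ ∑ j ∈ Finset.range K, (a (j + 1) - a j) ^ 2) :
    ∃ l : List (Module.Dual ℝ (V → ℝ)), l.length ≤ M ∧ ∀ u : V → ℝ, (∀ φ ∈ l, φ u = 0) →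
      c * ∑ x, u x ^ 2 ≤ energyOn G Finset.univ u := by
  -- Without any constraint the final open part may have no zero; one is then imposed at the root,
  -- which `1 ≤ M` allows.
  obtain ⟨m, s, h, hs, hm, hm0⟩ : ∃ m s, ZeroCut G c Finset.univ r m s ∧ s ≤ K ∧ m ≤ M ∧ m ≠ 0 := by
    by_cases h0 : m = 0
    · exact ⟨m + 1, 0, h.seal hs hc, Nat.zero_le _, by omega, by omega⟩
    · exact ⟨m, s, h, hs, hm, h0⟩
  obtain ⟨l, C, Z, hl, hr, hC, hsC, hm', H⟩ := h
  refine ⟨l, by omega, fun u hu => ?_⟩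
  obtain ⟨hz, e, hg, he⟩ := H u hu
  have h1 := hg.mul_sum_sq_le_of_zero (fun x => abs_nonneg _) (Z := Z) (K := K) (c := c)
    (fun z h => by simpa using hz z h) (hm'.resolve_left hm0) (hsC.trans hs) hc
  simp only [sq_abs] at h1
  rw [← Finset.sum_sdiff hC]
  linarith

/-! ### Cutting at edges by sign changes -/

/-- A choice of `m` linear constraints such that the energy is at least `c ∑ u²` off an open
connected part `C` with `s` vertices that contains the root, and leaves on `C` a potential of total
mass at least `β m`. -/
def PotentialCut {V : Type*} [DecidableEq V] (G : SimpleGraph V) (c : ℝ) (β : ℕ → ℝ) (T : Finset V)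
    (r : V) (m s : ℕ) : Prop :=
  ∃ (l : List (Module.Dual ℝ (V → ℝ))) (C : Finset V) (q : V → ℝ), l.length = m ∧ r ∈ C ∧ C ⊆ T ∧
    C.card = s ∧ (∀ x, 0 ≤ q x) ∧ β m ≤ ∑ x ∈ C, q x ∧ ∀ u : V → ℝ, (∀ φ ∈ l, φ u = 0) →
      ∃ e, DominatesGaps C (fun x => |u x|) e ∧
        e + ∑ x ∈ C, q x * u x ^ 2 + c * ∑ x ∈ T \ C, u x ^ 2 ≤ energyOn G T u

theorem potentialCut_singleton {V : Type*} [DecidableEq V] (G : SimpleGraph V) (c : ℝ) (β : ℕ → ℝ)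
    (hβ : β 0 = 0) (r : V) : PotentialCut G c β {r} r 0 1 := by
  refine ⟨[], {r}, 0, rfl, by simp, subset_rfl, by simp, by simp, by simp [hβ], fun u _ => ⟨0,
    dominatesGaps_singleton _ _, ?_⟩⟩
  simp [energyOn]

theorem PotentialCut.merge {V : Type*} [DecidableEq V] {G : SimpleGraph V} {c : ℝ} {β : ℕ → ℝ}
    {T₁ T₂ : Finset V} {r₁ r₂ : V} {m₁ m₂ s₁ s₂ : ℕ} (h₁ : PotentialCut G c β T₁ r₁ m₁ s₁)
    (h₂ : PotentialCut G c β T₂ r₂ m₂ s₂) (hβ : β (m₁ + m₂) ≤ β m₁ + β m₂)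
    (hd : Disjoint T₁ T₂) (hr : G.Adj r₁ r₂) :
    PotentialCut G c β (T₁ ∪ T₂) r₁ (m₁ + m₂) (s₁ + s₂) := by
  obtain ⟨l₁, C₁, q₁, hl₁, hr₁, hC₁, hs₁, hq₁, hb₁, H₁⟩ := h₁
  obtain ⟨l₂, C₂, q₂, hl₂, hr₂, hC₂, hs₂, hq₂, hb₂, H₂⟩ := h₂
  have hdC : Disjoint C₁ C₂ := hd.mono hC₁ hC₂
  let q : V → ℝ := fun x => if x ∈ C₁ then q₁ x else q₂ x
  have e₁ : ∀ x ∈ C₁, q x = q₁ x := fun x hx => if_pos hx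
  have e₂ : ∀ x ∈ C₂, q x = q₂ x := fun x hx => if_neg fun h => Finset.disjoint_left.1 hdC h hx
  refine ⟨l₁ ++ l₂, C₁ ∪ C₂, q, by simp [hl₁, hl₂],
    Finset.mem_union_left _ hr₁, Finset.union_subset_union hC₁ hC₂, ?_, ?_, ?_, ?_⟩
  · rw [Finset.card_union_of_disjoint hdC, hs₁, hs₂]
  · intro x
    simp only [q]
    split_ifs
    · exact hq₁ x
    · exact hq₂ x
  · rw [Finset.sum_union hdC, Finset.sum_congr rfl e₁, Finset.sum_congr rfl e₂]
    linarith
  · intro u hu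
    obtain ⟨a₁, hg₁, he₁⟩ := H₁ u fun φ hφ => hu φ (List.mem_append_left _ hφ)
    obtain ⟨a₂, hg₂, he₂⟩ := H₂ u fun φ hφ => hu φ (List.mem_append_right _ hφ)
    refine ⟨a₁ + a₂ + (u r₁ - u r₂) ^ 2, hg₁.union hg₂ hr₁ hr₂ (sq_abs_sub_abs_le _ _), ?_⟩
    rw [sum_union_sdiff_union hd hC₁ hC₂, Finset.sum_union hdC,
      Finset.sum_congr rfl fun x hx => by rw [e₁ x hx],
      Finset.sum_congr (s₁ := C₂) rfl fun x hx => by rw [e₂ x hx]]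
    linarith [energyOn_union hd (hC₁ hr₁) (hC₂ hr₂) hr u]

/-- A full open part of `T₂` is closed by a sign change across `r₁r₂`. Its own mass `β m₂` and the
share `b / (b - 1)` of the edge add up to at least `lam`, while the share `b = β (m₂ + 1)` is passed
on to `r₁`. -/
theorem PotentialCut.attach {V : Type*} [DecidableEq V] {G : SimpleGraph V} {c lam : ℝ}
    {β : ℕ → ℝ} {T₁ T₂ : Finset V} {r₁ r₂ : V} {m₁ m₂ s₁ k : ℕ}
    (h₁ : PotentialCut G c β T₁ r₁ m₁ s₁) (h₂ : PotentialCut G c β T₂ r₂ m₂ k) (hk : 1 ≤ k)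
    (hβ : β (m₁ + (m₂ + 1)) ≤ β m₁ + β (m₂ + 1)) (hβ1 : 1 < β (m₂ + 1))
    (hlam : lam ≤ β m₂ + β (m₂ + 1) / (β (m₂ + 1) - 1))
    (hc : ∀ a : ℕ → ℝ, c * ∑ j ∈ Finset.range k, a (j + 1) ^ 2 ≤
      lam * a 1 ^ 2 + ∑ j ∈ Finset.Ico 1 k, (a (j + 1) - a j) ^ 2)
    (hd : Disjoint T₁ T₂) (hr : G.Adj r₁ r₂) :
    PotentialCut G c β (T₁ ∪ T₂) r₁ (m₁ + (m₂ + 1)) s₁ := by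
  obtain ⟨l₁, C₁, q₁, hl₁, hr₁, hC₁, hs₁, hq₁, hb₁, H₁⟩ := h₁
  obtain ⟨l₂, C₂, q₂, hl₂, hr₂, hC₂, hs₂, hq₂, hb₂, H₂⟩ := h₂
  set b := β (m₂ + 1) with hb
  have hb1 : 0 < b - 1 := by linarith
  have hsum : ∀ (C : Finset V) (q f : V → ℝ) (r : V) (t : ℝ), r ∈ C →
      ∑ x ∈ C, (q + (Pi.single r t : V → ℝ)) x * f x = ∑ x ∈ C, q x * f x + t * f r := by
    intro C q f r t hrC
    simp only [Pi.add_apply, add_mul, Finset.sum_add_distrib]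
    congr 1
    rw [Finset.sum_eq_single r]
    · simp
    · intro x _ hx
      simp [hx]
    · exact fun h => absurd hrC h
  have hnn : ∀ (q : V → ℝ) (r : V) (t : ℝ), (∀ x, 0 ≤ q x) → 0 ≤ t →
      ∀ x, 0 ≤ (q + (Pi.single r t : V → ℝ)) x := by
    intro q r t hq ht x
    refine add_nonneg (hq x) ?_
    by_cases hx : x = r
    · subst hx
      simpa using ht
    · simp [hx]
  -- The new constraint is `u r₂ = -(b - 1) u r₁`, the ratio at which the edge energy equals the two
  -- potentials exactly.
  refine ⟨l₁ ++ (LinearMap.proj r₂ + (b - 1) • LinearMap.proj r₁) :: l₂, C₁, q₁ + Pi.single r₁ b,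
    by simp [hl₁, hl₂], hr₁, hC₁.trans Finset.subset_union_left, hs₁,
    hnn q₁ r₁ b hq₁ (by linarith), ?_, fun u hu => ?_⟩
  · have := hsum C₁ q₁ 1 r₁ b hr₁
    simp only [Pi.one_apply, mul_one] at this
    rw [this]
    linarith
  obtain ⟨e₁, hg₁, he₁⟩ := H₁ u fun φ hφ => hu φ (List.mem_append_left _ hφ)
  obtain ⟨e₂, hg₂, he₂⟩ := H₂ u fun φ hφ =>
    hu φ (List.mem_append_right _ (List.mem_cons_of_mem _ hφ))
  have hrel : u r₂ + (b - 1) * u r₁ = 0 :=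
    hu _ (List.mem_append_right _ List.mem_cons_self)
  refine ⟨e₁, hg₁, ?_⟩
  have h1 := hg₂.mul_sum_sq_le_of_potential (fun x => abs_nonneg _) hs₂ hk
    (hnn q₂ r₂ (b / (b - 1)) hq₂ (div_nonneg (by linarith) hb1.le)) (lam := lam) (c := c) (by
      have := hsum C₂ q₂ 1 r₂ (b / (b - 1)) hr₂
      simp only [Pi.one_apply, mul_one] at this
      rw [this]
      linarith) hc
  simp only [sq_abs] at h1
  rw [hsum C₂ q₂ (fun x => u x ^ 2) r₂ _ hr₂] at h1
  rw [hsum C₁ q₁ (fun x => u x ^ 2) r₁ _ hr₁]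
  have h2 := Finset.sum_sdiff (f := fun x => u x ^ 2) hC₂
  rw [sum_union_sdiff hd hC₁, ← h2]
  have h3 := energyOn_union hd (hC₁ hr₁) (hC₂ hr₂) hr u
  have h4 : (u r₁ - u r₂) ^ 2 = b * u r₁ ^ 2 + b / (b - 1) * u r₂ ^ 2 := by
    have : u r₂ = -((b - 1) * u r₁) := by linarith
    rw [this]
    field_simp
    ring
  linarith

/-- Properties of the masses `β m` that let pieces of equal size be separated by sign changes. -/
structure IsMassSequence (lam : ℝ) (i : ℕ) (β : ℕ → ℝ) : Prop where
  zero : β 0 = 0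
  subadditive : ∀ a b, a + b < i → β (a + b) ≤ β a + β b
  one_lt : ∀ m, 1 ≤ m → m < i → 1 < β m
  le_add : ∀ m, m + 1 < i → lam ≤ β m + β (m + 1) / (β (m + 1) - 1)
  le_last : lam ≤ β (i - 1)

/-- In the first alternative the count is exact: each closed piece has `k` vertices. A zero cut of
the same cost is carried along, so that one can switch to zeros as soon as two open parts do not fit
together. Such an overflow leaves a vertex to spare, hence the strict count in the second
alternative, and this slack survives all later grafts. -/
theorem IsRootedPiece.exists_potentialCut_or_zeroCut {V : Type*} [DecidableEq V]
    {G : SimpleGraph V} {c lam : ℝ} {i k : ℕ} (hk : 2 ≤ k) {β : ℕ → ℝ} (hβ : IsMassSequence lam i β)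
    (hc : ∀ a : ℕ → ℝ, c * ∑ j ∈ Finset.range k, a (j + 1) ^ 2 ≤
      lam * a 1 ^ 2 + ∑ j ∈ Finset.Ico 1 k, (a (j + 1) - a j) ^ 2)
    (hc0 : ∀ a : ℕ → ℝ, a 0 = 0 → c * ∑ j ∈ Finset.range (k - 1), a (j + 1) ^ 2 ≤
      ∑ j ∈ Finset.range (k - 1), (a (j + 1) - a j) ^ 2)
    {T : Finset V} {r : V} (h : IsRootedPiece G T r) : T.card ≤ i * k →
    (∃ m s, 1 ≤ s ∧ T.card = m * k + s ∧ PotentialCut G c β T r m s ∧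
      (s < k ∧ ZeroCut G c T r m s ∨ s = k ∧ ZeroCut G c T r (m + 1) 0)) ∨
    ∃ m s, s < k ∧ m * k + s < T.card ∧ ZeroCut G c T r m s := by
  induction h with
  | single r =>
    intro _
    exact Or.inl ⟨0, 1, le_rfl, by simp, potentialCut_singleton G c β hβ.zero r,
      Or.inl ⟨by omega, zeroCut_singleton G c r⟩⟩
  | @graft T₁ T₂ r₁ r₂ p₁ p₂ hd hr ih₁ ih₂ =>
    rw [Finset.card_union_of_disjoint hd]
    intro hT
    have hpos : 0 < T₂.card := Finset.card_pos.2 ⟨_, p₂.root_mem⟩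
    -- grafting zero cuts, with overflow
    have hZ : ∀ m₁ s₁ m₂ s₂, s₁ < k → s₂ < k → ZeroCut G c T₁ r₁ m₁ s₁ →
        ZeroCut G c T₂ r₂ m₂ s₂ → ∃ m s, s < k ∧ m * k + s ≤ (m₁ * k + s₁) + (m₂ * k + s₂) ∧
          ZeroCut G c (T₁ ∪ T₂) r₁ m s := by
      intro m₁ s₁ m₂ s₂ hs₁ hs₂ h₁ h₂
      by_cases h : s₁ + s₂ < k
      · exact ⟨_, _, h, by linarith, h₁.merge h₂ hd hr⟩
      · refine ⟨_, _, by omega, ?_,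
          (h₁.seal (by omega) hc0).graft_of_sealed h₂ (K := k - 1) (by omega) hd hr hc0⟩
        push Not at h
        linarith
    have hweak : ∀ {T : Finset V} {r : V}, ((∃ m s, 1 ≤ s ∧ T.card = m * k + s ∧
        PotentialCut G c β T r m s ∧
        (s < k ∧ ZeroCut G c T r m s ∨ s = k ∧ ZeroCut G c T r (m + 1) 0)) ∨
        ∃ m s, s < k ∧ m * k + s < T.card ∧ ZeroCut G c T r m s) →
        ∃ m s, s < k ∧ m * k + s ≤ T.card ∧ ZeroCut G c T r m s := by
      rintro T r (⟨m, s, hs, hT, -, ⟨hsk, h⟩ | ⟨rfl, h⟩⟩ | ⟨m, s, hs, hT, h⟩)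
      · exact ⟨m, s, hsk, hT.ge, h⟩
      · exact ⟨m + 1, 0, by omega, by rw [hT]; linarith, h⟩
      · exact ⟨m, s, hs, hT.le, h⟩
    have j₁ := ih₁ (by omega)
    have j₂ := ih₂ (by omega)
    obtain ⟨a₁, t₁, ht₁, hn₁, hz₁⟩ := hweak j₁
    obtain ⟨a₂, t₂, ht₂, hn₂, hz₂⟩ := hweak j₂
    rcases j₁ with ⟨m₁, s₁, hs₁, hT₁, hp₁, hz₁'⟩ | ⟨m₁, s₁, hs₁, hT₁, h₁⟩
    swap
    · obtain ⟨m, s, hs, hms, h⟩ := hZ _ _ _ _ hs₁ ht₂ h₁ hz₂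
      exact Or.inr ⟨m, s, hs, by omega, h⟩
    rcases j₂ with ⟨m₂, s₂, hs₂, hT₂, hp₂, hz₂'⟩ | ⟨m₂, s₂, hs₂, hT₂, h₂⟩
    swap
    · obtain ⟨m, s, hs, hms, h⟩ := hZ _ _ _ _ ht₁ hs₂ hz₁ h₂
      exact Or.inr ⟨m, s, hs, by omega, h⟩
    rcases hz₂' with ⟨hs₂k, hz₂'⟩ | ⟨rfl, hz₂'⟩
    · by_cases hsum : s₁ + s₂ ≤ k
      · left
        have hm : m₁ + m₂ < i := by
          by_contra hm
          push Not at hm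
          have := Nat.mul_le_mul_right k hm
          rw [add_mul] at this
          omega
        have hs₁k : s₁ < k := by omega
        refine ⟨m₁ + m₂, s₁ + s₂, by omega, by rw [hT₁, hT₂]; ring,
          hp₁.merge hp₂ (hβ.subadditive _ _ hm) hd hr, ?_⟩
        have hz₁'' : ZeroCut G c T₁ r₁ m₁ s₁ := by
          rcases hz₁' with h | h
          · exact h.2
          · omega
        rcases hsum.lt_or_eq with h | h
        · exact Or.inl ⟨h, hz₁''.merge hz₂' hd hr⟩
        · refine Or.inr ⟨h, ?_⟩
          have := (hz₁''.seal (by omega) hc0).graft_of_sealed hz₂' (K := k - 1) (by omega) hd hr hc0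
          rwa [add_right_comm] at this
      -- Overflow: one zero at `r₁` settles more than `k` open vertices, which makes the count
      -- strict.
      · right
        rcases hz₁' with ⟨hs₁k, hz₁'⟩ | ⟨rfl, hz₁'⟩
        · refine ⟨m₁ + 1 + m₂, 0, by omega, ?_,
            (hz₁'.seal (by omega) hc0).graft_of_sealed hz₂' (K := k - 1) (by omega) hd hr hc0⟩
          rw [hT₁, hT₂]
          linarith
        · refine ⟨m₁ + 1 + m₂, 0, by omega, ?_,
            hz₁'.graft_of_sealed hz₂' (K := s₁ - 1) (by omega) hd hr hc0⟩
          rw [hT₁, hT₂]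
          linarith
    -- The open part of `T₂` is full and is closed by a sign change, so the open part of `T₁` does
    -- not grow.
    · left
      have hm : m₁ + (m₂ + 1) < i := by
        by_contra hm
        push Not at hm
        have := Nat.mul_le_mul_right s₂ hm
        rw [add_mul, add_mul] at this
        omega
      refine ⟨m₁ + (m₂ + 1), s₁, hs₁, by rw [hT₁, hT₂]; ring,
        hp₁.attach hp₂ hs₂ (hβ.subadditive _ _ hm) (hβ.one_lt _ (by omega) (by omega))
          (hβ.le_add _ (by omega)) hc hd hr, ?_⟩
      rcases hz₁' with ⟨hs₁k, hz₁'⟩ | ⟨rfl, hz₁'⟩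
      · exact Or.inl ⟨hs₁k, hz₁'.merge hz₂' hd hr⟩
      · refine Or.inr ⟨rfl, ?_⟩
        have := hz₁'.merge hz₂' hd hr
        rwa [add_right_comm] at this

/-- Constraints for a connected graph with `i * k` vertices. -/
theorem exists_constraints_of_card_eq_mul {V : Type*} [Fintype V] {G : SimpleGraph V}
    (hG : G.Connected) {c lam : ℝ} {i k : ℕ} (hi : 2 ≤ i) (hk : 2 ≤ k) {β : ℕ → ℝ}
    (hβ : IsMassSequence lam i β) (hV : Fintype.card V = i * k)
    (hc : ∀ a : ℕ → ℝ, c * ∑ j ∈ Finset.range k, a (j + 1) ^ 2 ≤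
      lam * a 1 ^ 2 + ∑ j ∈ Finset.Ico 1 k, (a (j + 1) - a j) ^ 2) :
    ∃ l : List (Module.Dual ℝ (V → ℝ)), l.length ≤ i - 1 ∧ ∀ u : V → ℝ, (∀ φ ∈ l, φ u = 0) →
      c * ∑ x, u x ^ 2 ≤ energyOn G Finset.univ u := by
  classical
  have hc0 : ∀ a : ℕ → ℝ, a 0 = 0 → c * ∑ j ∈ Finset.range (k - 1), a (j + 1) ^ 2 ≤
      ∑ j ∈ Finset.range (k - 1), (a (j + 1) - a j) ^ 2 := by
    intro a ha
    obtain ⟨k, rfl⟩ : ∃ k', k = k' + 1 := ⟨k - 1, by omega⟩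
    -- Truncated subtraction gives the test sequence the value `a 0 = 0` at position `1`. This
    -- removes the potential term and leaves a Dirichlet path with `k - 1` free vertices.
    have := hc fun j => a (j - 1)
    rw [Finset.sum_range_succ', Finset.sum_Ico_eq_sum_range] at this
    simpa [ha, add_comm] using this
  obtain ⟨r⟩ := hG.nonempty
  have hcard : (Finset.univ : Finset V).card = i * k := by rw [Finset.card_univ, hV]
  rcases (isRootedPiece_univ hG r).exists_potentialCut_or_zeroCut hk hβ hc hc0 hcard.le with
    ⟨m, s, hs, hms, h, hz⟩ | ⟨m, s, hs, hms, h⟩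
  · have hsk : s ≤ k := by
      rcases hz with h | h <;> omega
    -- With `1 ≤ s ≤ k`, the exact count `i * k = m * k + s` forces `m = i - 1` and `s = k`: the
    -- last open part is one more full piece, with mass `β (i - 1) ≥ lam`.
    have hm : m + 1 = i := by
      rw [hcard] at hms
      apply le_antisymm
      · by_contra hlt
        push Not at hlt
        have := Nat.mul_le_mul_right k (Nat.le_of_lt_succ hlt)
        omega
      · by_contra hlt
        push Not at hlt
        have := Nat.mul_le_mul_right k hlt
        rw [Nat.succ_mul, Nat.succ_mul] at this
        omega
    have hs' : s = k := by
      rw [hcard, ← hm, Nat.succ_mul] at hms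
      omega
    obtain ⟨l, C, q, hl, -, hC, hsC, hq, hb, H⟩ := h
    refine ⟨l, by omega, fun u hu => ?_⟩
    obtain ⟨e, hg, he⟩ := H u hu
    have hlast := hβ.le_last
    have hm' : i - 1 = m := by omega
    rw [hm'] at hlast
    have h1 := hg.mul_sum_sq_le_of_potential (fun x => abs_nonneg _) (hsC.trans hs') (by omega) hq
      (hlast.trans hb) hc
    simp only [sq_abs] at h1
    rw [← Finset.sum_sdiff hC]
    linarith
  · refine h.exists_constraints (K := k - 1) (by omega) ?_ (by omega) hc0
    rw [hcard] at hms
    have : m < i := by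
      by_contra hlt
      push Not at hlt
      have := Nat.mul_le_mul_right k hlt
      omega
    omega

/-- Constraints for a connected graph with fewer than `i * (k + 1)` vertices. -/
theorem exists_constraints_of_card_lt {V : Type*} [Fintype V] {G : SimpleGraph V}
    (hG : G.Connected) {c : ℝ} {i k : ℕ} (hi : 2 ≤ i) (hk : 1 ≤ k)
    (hV : Fintype.card V < i * (k + 1))
    (hc : ∀ a : ℕ → ℝ, a 0 = 0 →
      c * ∑ j ∈ Finset.range k, a (j + 1) ^ 2 ≤ ∑ j ∈ Finset.range k, (a (j + 1) - a j) ^ 2) :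
    ∃ l : List (Module.Dual ℝ (V → ℝ)), l.length ≤ i - 1 ∧ ∀ u : V → ℝ, (∀ φ ∈ l, φ u = 0) →
      c * ∑ x, u x ^ 2 ≤ energyOn G Finset.univ u := by
  classical
  obtain ⟨r⟩ := hG.nonempty
  obtain ⟨m, s, hs, hms, h⟩ := (isRootedPiece_univ hG r).exists_zeroCut hk hc
  rw [Finset.card_univ] at hms
  refine h.exists_constraints hs ?_ (by omega) hc
  have : m < i := by
    by_contra hlt
    push Not at hlt
    have := Nat.mul_le_mul_right (k + 1) hlt
    omega
  omega

/-! ### Quadratic forms and path eigenvalues -/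

theorem laplacian_form {V : Type*} [Fintype V] (w : V → V → ℝ) (hs : ∀ x y, w x y = w y x)
    (u v : V → ℝ) :
    ∑ x, (-laplacian (fun _ => 1) w) u x * v x =
      1 / 2 * ∑ x, ∑ y, w x y * ((u y - u x) * (v y - v x)) := by
  have := energy_identity (fun _ => 1) w (fun _ => one_pos) hs u v
  simp only [LinearMap.neg_apply, Pi.neg_apply, neg_mul, Finset.sum_neg_distrib]
  simp only [one_mul] at this
  linarith

theorem laplacian_symmetric {V : Type*} [Fintype V] (w : V → V → ℝ) (hs : ∀ x y, w x y = w y x)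
    (u v : V → ℝ) :
    ∑ x, (-laplacian (fun _ => 1) w) u x * v x = ∑ x, u x * (-laplacian (fun _ => 1) w) v x := by
  rw [laplacian_form w hs, Finset.sum_congr rfl fun x _ => mul_comm (u x) _, laplacian_form w hs]
  simp only [mul_comm]

theorem extendByZero_apply_mem {V : Type*} (S : Set V) (f : S → ℝ) (x : S) :
    Function.ExtendByZero.linearMap ℝ (Subtype.val : S → V) f x = f x :=
  Subtype.val_injective.extend_apply f (0 : V → ℝ) x

theorem extendByZero_apply_notMem {V : Type*} (S : Set V) (f : S → ℝ) (x : V) (hx : x ∉ S) :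
    Function.ExtendByZero.linearMap ℝ (Subtype.val : S → V) f x = 0 :=
  Function.extend_apply' f (0 : V → ℝ) x fun ⟨a, ha⟩ => hx (ha ▸ a.2)

theorem sum_subtype_eq {V : Type*} [Fintype V] (S : Set V) [Fintype S] (g : V → ℝ)
    (hg : ∀ x ∉ S, g x = 0) : ∑ x : S, g x = ∑ x, g x := by
  classical
  refine Finset.sum_of_injOn Subtype.val Subtype.val_injective.injOn (by simp) ?_ (by simp)
  intro x _ hx
  exact hg x fun h => hx ⟨⟨x, h⟩, by simp, rfl⟩

theorem dirichletLaplacian_form {V : Type*} [Fintype V] (w : V → V → ℝ) (B : Set V)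
    [Fintype (Bᶜ : Set V)] (f g : (Bᶜ : Set V) → ℝ) :
    ∑ x, dirichletLaplacian (fun _ => 1) w B f x * g x =
      ∑ x, (-laplacian (fun _ => 1) w) (Function.ExtendByZero.linearMap ℝ Subtype.val f) x *
        Function.ExtendByZero.linearMap ℝ (Subtype.val : (Bᶜ : Set V) → V) g x := by
  rw [← sum_subtype_eq Bᶜ]
  · refine Finset.sum_congr rfl fun x _ => ?_
    rw [extendByZero_apply_mem]
    rfl
  · intro x hx
    rw [extendByZero_apply_notMem _ _ _ hx, mul_zero]

theorem dirichletLaplacian_symmetric {V : Type*} [Fintype V] (w : V → V → ℝ)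
    (hs : ∀ x y, w x y = w y x) (B : Set V) [Fintype (Bᶜ : Set V)] (f g : (Bᶜ : Set V) → ℝ) :
    ∑ x, dirichletLaplacian (fun _ => 1) w B f x * g x =
      ∑ x, f x * dirichletLaplacian (fun _ => 1) w B g x := by
  rw [dirichletLaplacian_form, laplacian_symmetric w hs,
    Finset.sum_congr rfl fun x _ => mul_comm (f x) _, dirichletLaplacian_form]
  exact Finset.sum_congr rfl fun x _ => mul_comm _ _

theorem sum_pathGraph (n : ℕ) (F : ℕ → ℕ → ℝ) (hF : ∀ p q, F p q = F q p) :
    1 / 2 * ∑ x : Fin (n + 1), ∑ y : Fin (n + 1),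
        unitWeight (SimpleGraph.pathGraph (n + 1)) x y * F x y =
      ∑ j ∈ Finset.range n, F j (j + 1) := by
  classical
  have hw : ∀ x y : Fin (n + 1), unitWeight (SimpleGraph.pathGraph (n + 1)) x y * F x y =
      (if x.val + 1 = y.val then F x y else 0) + (if y.val + 1 = x.val then F y x else 0) := by
    intro x y
    rw [unitWeight]
    by_cases h1 : x.val + 1 = y.val
    · rw [if_pos (SimpleGraph.pathGraph_adj.2 (Or.inl h1)), if_pos h1, if_neg (by omega)]
      ring
    · by_cases h2 : y.val + 1 = x.val
      · rw [if_pos (SimpleGraph.pathGraph_adj.2 (Or.inr h2)), if_neg h1, if_pos h2, hF]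
        ring
      · rw [if_neg fun h => (SimpleGraph.pathGraph_adj.1 h).elim h1 h2, if_neg h1, if_neg h2]
        ring
  have hS : ∑ x : Fin (n + 1), ∑ y : Fin (n + 1), (if x.val + 1 = y.val then F x y else 0) =
      ∑ j ∈ Finset.range n, F j (j + 1) := by
    rw [Fin.sum_univ_castSucc, Finset.sum_range]
    have hlast : ∑ y : Fin (n + 1), (if (Fin.last n).val + 1 = y.val then F (Fin.last n) y else 0)
        = 0 := Finset.sum_eq_zero fun y _ => if_neg (by simp; omega)
    rw [hlast, add_zero]
    refine Finset.sum_congr rfl fun j _ => ?_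
    rw [Finset.sum_eq_single j.succ]
    · simp
    · intro y _ hy
      refine if_neg fun h => hy ?_
      ext
      simp at h ⊢
      omega
    · simp
  have hS' : ∑ x : Fin (n + 1), ∑ y : Fin (n + 1), (if y.val + 1 = x.val then F y x else 0) =
      ∑ j ∈ Finset.range n, F j (j + 1) := by
    rw [Finset.sum_comm]
    exact hS
  simp only [hw, Finset.sum_add_distrib, hS, hS']
  ring

theorem pathWeight_comm (k : ℕ) (lam : ℝ) (x y : Fin (k + 1)) :
    pathWeight k lam x y = pathWeight k lam y x := by
  have h : (x = 0 ∨ y = 0) ↔ (y = 0 ∨ x = 0) := or_comm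
  simp only [pathWeight, h, unitWeight_comm _ x y]

theorem pathWeight_form (k : ℕ) (hk : 1 ≤ k) (lam : ℝ) (a : ℕ → ℝ) (ha : a 0 = 0) :
    1 / 2 * ∑ x : Fin (k + 1), ∑ y : Fin (k + 1),
        pathWeight k lam x y * ((a y - a x) * (a y - a x)) =
      lam * a 1 ^ 2 + ∑ j ∈ Finset.Ico 1 k, (a (j + 1) - a j) ^ 2 := by
  have h := sum_pathGraph k
    (fun p q => (if p = 0 ∨ q = 0 then lam else 1) * ((a q - a p) * (a q - a p)))
    (fun p q => by
      have h : (p = 0 ∨ q = 0) ↔ (q = 0 ∨ p = 0) := or_comm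
      simp only [h]
      ring)
  have hw : ∀ x y : Fin (k + 1), pathWeight k lam x y * ((a y - a x) * (a y - a x)) =
      unitWeight (SimpleGraph.pathGraph (k + 1)) x y *
        ((if x.val = 0 ∨ y.val = 0 then lam else 1) * ((a y - a x) * (a y - a x))) := by
    intro x y
    rw [pathWeight]
    simp only [Fin.ext_iff, Fin.val_zero]
    ring
  simp only [hw]
  rw [h, Finset.range_eq_Ico, Finset.sum_eq_sum_Ico_succ_bot hk]
  congr 1
  · rw [if_pos (Or.inl rfl), ha]
    ring
  · refine Finset.sum_congr rfl fun j hj => ?_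
    rw [Finset.mem_Ico] at hj
    rw [if_neg (by omega)]
    ring

/-- The variational characterization of `𝒫(k, lam)`, as a lower bound. -/
theorem pathDirichlet_mul_le (k : ℕ) (hk : 1 ≤ k) (lam : ℝ) (a : ℕ → ℝ) :
    pathDirichlet k lam * ∑ j ∈ Finset.range k, a (j + 1) ^ 2 ≤
      lam * a 1 ^ 2 + ∑ j ∈ Finset.Ico 1 k, (a (j + 1) - a j) ^ 2 := by
  classical
  -- The value at the Dirichlet vertex is reset to `0`, since `a 0` is arbitrary.
  let b : ℕ → ℝ := fun j => if j = 0 then 0 else a j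
  have hb : ∀ j, 1 ≤ j → b j = a j := fun j hj => if_neg (by omega)
  let f : (({0} : Set (Fin (k + 1)))ᶜ : Set (Fin (k + 1))) → ℝ := fun x => b x.1.val
  have hf : Function.ExtendByZero.linearMap ℝ Subtype.val f = fun x : Fin (k + 1) => b x.val := by
    funext x
    by_cases hx : x ∈ (({0} : Set (Fin (k + 1)))ᶜ : Set (Fin (k + 1)))
    · exact extendByZero_apply_mem _ f ⟨x, hx⟩
    · rw [extendByZero_apply_notMem _ _ _ hx]
      have : x = 0 := by simpa using hx
      simp [this, b]
  have h := orderedEigenvalue_one_mul_le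
    (dirichletLaplacian (fun _ => 1) (pathWeight k lam) {0})
    (dirichletLaplacian_symmetric _ (pathWeight_comm k lam) _) f
  rw [dirichletLaplacian_form, hf, laplacian_form _ (pathWeight_comm k lam),
    pathWeight_form k hk lam b rfl, hb 1 le_rfl] at h
  have h1 : ∑ x, f x * f x = ∑ j ∈ Finset.range k, a (j + 1) ^ 2 := by
    have : ∑ x, f x * f x = ∑ x : Fin (k + 1), b x.val * b x.val := by
      rw [← sum_subtype_eq (({0} : Set (Fin (k + 1)))ᶜ : Set (Fin (k + 1)))]
      intro x hx
      have : x = 0 := by simpa using hx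
      simp [this, b]
    rw [this, Fin.sum_univ_succ, Finset.sum_range]
    simp [b, sq]
  rw [h1] at h
  refine h.trans (le_of_eq ?_)
  congr 1
  refine Finset.sum_congr rfl fun j hj => ?_
  rw [Finset.mem_Ico] at hj
  rw [hb j hj.1, hb _ (by omega)]

theorem pathDirichlet_lt_one (k : ℕ) (hk : 2 ≤ k) (lam : ℝ) (hlam : lam ≤ 4) :
    pathDirichlet k lam < 1 := by
  by_contra h
  push Not at h
  -- For `lam ≤ 4` and `k ≥ 2` this test sequence has Rayleigh quotient at most `(4/16 + 9/16) /
  -- (1/16 + 1) = 13/17`.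
  have h1 := pathDirichlet_mul_le k (by omega) lam fun j => if j ≤ 1 then 1 / 4 else 1
  obtain ⟨k, rfl⟩ : ∃ k', k = k' + 2 := ⟨k - 2, by omega⟩
  have h2 : ∑ j ∈ Finset.Ico 1 (k + 2), (((if j + 1 ≤ 1 then 1 / 4 else 1 : ℝ)) -
      (if j ≤ 1 then 1 / 4 else 1)) ^ 2 = 9 / 16 := by
    rw [Finset.sum_eq_single 1]
    · norm_num
    · intro j hj hj1
      rw [Finset.mem_Ico] at hj
      rw [if_neg (by omega), if_neg (by omega)]
      norm_num
    · simp
  rw [h2, Finset.sum_range_succ'] at h1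
  have h3 : ∑ j ∈ Finset.range (k + 1), ((if j + 1 + 1 ≤ 1 then 1 / 4 else 1 : ℝ)) ^ 2 = k + 1 := by
    simp
  rw [h3] at h1
  have hk0 : (0 : ℝ) ≤ k := Nat.cast_nonneg k
  norm_num at h1
  nlinarith

/-- With alternating signs, `φ` is an eigenvector for `Λ`, and the boundary relations are the
Neumann conditions at the two ends. Positivity of `φ` lets each `(a (m + 1) - a m) ^ 2` be bounded
by a weighted sum of squares; by the recurrence the weights at each vertex total `Λ`. -/
theorem pathTopEigenvalue_le (i : ℕ) (hi : 1 ≤ i) (φ : ℕ → ℝ) (Λ : ℝ)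
    (hφ : ∀ j, j < i → 0 < φ (j + 1)) (h0 : φ 0 = -φ 1) (hi1 : φ (i + 1) = -φ i)
    (hΛ : ∀ j, φ j + φ (j + 2) = (Λ - 2) * φ (j + 1)) : pathTopEigenvalue i ≤ Λ := by
  obtain ⟨n, rfl⟩ : ∃ n, i = n + 1 := ⟨i - 1, by omega⟩
  obtain ⟨f, hf0, hf⟩ := exists_eigenvector_orderedEigenvalue
    (-laplacian (fun _ : Fin (n + 1) => (1 : ℝ)) (unitWeight (SimpleGraph.pathGraph (n + 1))))
    (laplacian_symmetric _ (unitWeight_comm _)) (n + 1) hi (by simp)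
  change _ = pathTopEigenvalue (n + 1) • f at hf
  set t := pathTopEigenvalue (n + 1)
  have h1 := laplacian_form _ (unitWeight_comm (SimpleGraph.pathGraph (n + 1))) f f
  rw [hf] at h1
  let a : ℕ → ℝ := fun j => if h : j < n + 1 then f ⟨j, h⟩ else 0
  have ha : ∀ x : Fin (n + 1), f x = a x.val := fun x => by
    simp only [a, dif_pos x.2]
  simp only [ha] at h1
  rw [sum_pathGraph n (fun p q => (a q - a p) * (a q - a p)) (fun p q => by ring)] at h1
  have hS : ∑ x : Fin (n + 1), (t • f) x * a x = t * ∑ j ∈ Finset.range (n + 1), a j ^ 2 := by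
    rw [Finset.sum_range, Finset.mul_sum]
    refine Finset.sum_congr rfl fun x _ => ?_
    simp only [Pi.smul_apply, smul_eq_mul, ha]
    ring
  rw [hS] at h1
  -- The extra term is the share of vertex `m` in the bound for the next edge; at `m = n` its
  -- coefficient vanishes because `φ (n + 2) = -φ (n + 1)`.
  have key : ∀ m, m ≤ n → ∑ j ∈ Finset.range m, (a (j + 1) - a j) * (a (j + 1) - a j) +
      (1 + φ (m + 2) / φ (m + 1)) * a m ^ 2 ≤ Λ * ∑ j ∈ Finset.range (m + 1), a j ^ 2 := by
    intro m
    induction m with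
    | zero =>
      intro _
      have h := hΛ 0
      have hp := hφ 0 (by omega)
      rw [h0] at h
      simp only [zero_add] at h hp ⊢
      have : φ 2 / φ 1 = Λ - 1 := by
        rw [div_eq_iff hp.ne']
        linarith
      simp [this]
    | succ m ih =>
      intro hm
      have h := hΛ (m + 1)
      have hp := hφ m (by omega)
      have hp' := hφ (m + 1) (by omega)
      rw [Finset.sum_range_succ, Finset.sum_range_succ _ (m + 1)]
      have e1 : φ (m + 1 + 2) / φ (m + 1 + 1) = Λ - 2 - φ (m + 1) / φ (m + 2) := by
        rw [div_eq_iff hp'.ne', sub_mul]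
        rw [div_mul_cancel₀ _ hp'.ne']
        linarith
      rw [e1]
      have e2 : (a (m + 1) - a m) * (a (m + 1) - a m) ≤
          (1 + φ (m + 2) / φ (m + 1)) * a m ^ 2 + (1 + φ (m + 1) / φ (m + 2)) * a (m + 1) ^ 2 := by
        have e3 : 0 ≤ (φ (m + 2) * a m + φ (m + 1) * a (m + 1)) ^ 2 / (φ (m + 1) * φ (m + 2)) :=
          div_nonneg (sq_nonneg _) (mul_pos hp hp').le
        have e4 : (φ (m + 2) * a m + φ (m + 1) * a (m + 1)) ^ 2 / (φ (m + 1) * φ (m + 2)) =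
            φ (m + 2) / φ (m + 1) * a m ^ 2 + φ (m + 1) / φ (m + 2) * a (m + 1) ^ 2 +
              2 * (a m * a (m + 1)) := by
          have := hp.ne'
          have h' : φ (m + 2) ≠ 0 := hp'.ne'
          field_simp
          ring
        rw [e4] at e3
        nlinarith
      have := ih (by omega)
      linarith
  have hk := key n le_rfl
  have hlast : φ (n + 2) / φ (n + 1) = -1 := by
    rw [div_eq_iff (hφ n (by omega)).ne', hi1]
    ring
  rw [hlast] at hk
  have hle : t * ∑ j ∈ Finset.range (n + 1), a j ^ 2 ≤ Λ * ∑ j ∈ Finset.range (n + 1), a j ^ 2 := by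
    rw [h1]
    linarith
  refine le_of_mul_le_mul_right hle ?_
  refine lt_of_le_of_ne (Finset.sum_nonneg fun _ _ => sq_nonneg _) fun h => hf0 ?_
  rw [eq_comm, Finset.sum_eq_zero_iff_of_nonneg fun _ _ => sq_nonneg _] at h
  funext x
  rw [ha]
  exact pow_eq_zero_iff two_ne_zero |>.1 (h x.val (Finset.mem_range.2 x.2))

/-! ### Explicit path eigenvectors and the mass sequence -/

section Trigonometry

open Real

/-- The difference of the two sides is `sin A * sin B * sin (A + B + 2 * x)`. After clearing
denominators this is the subadditivity of the masses. -/
theorem sin_mul_add_ge (A B x : ℝ) (hA : 0 ≤ sin A) (hB : 0 ≤ sin B)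
    (h : 0 ≤ sin (A + B + 2 * x)) :
    sin (A + B) * sin (A + x) * sin (B + x) ≤
      (sin A * sin (B + x) + sin B * sin (A + x)) * sin (A + B + x) := by
  have key : (sin A * sin (B + x) + sin B * sin (A + x)) * sin (A + B + x) -
      sin (A + B) * sin (A + x) * sin (B + x) = sin A * sin B * sin (A + B + 2 * x) := by
    have e1 : sin (A + x) * sin (A + B) - sin A * sin (A + B + x) = sin B * sin x := by
      simp only [sin_add, cos_add]
      linear_combination (sin B * sin x) * sin_sq_add_cos_sq A
    have e2 : sin (A + x) * sin (A + B + x) - sin x * sin (B + x) = sin A * sin (A + B + 2 * x) := by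
      have : sin (A + B + 2 * x) = sin ((A + x) + (B + x)) := by ring_nf
      rw [this, sin_add (A + x), show A + B + x = A + (B + x) by ring, sin_add A (B + x), cos_add A x,
        sin_add A x]
      linear_combination (sin x * sin (B + x)) * sin_sq_add_cos_sq A
    linear_combination (-sin (B + x)) * e1 + sin B * e2
  have := mul_nonneg (mul_nonneg hA hB) h
  linarith

/-- The step `π / (2 i)` in the top eigenvector of the path with `i` vertices. -/
noncomputable def pathStep (i : ℕ) : ℝ := π / (2 * i)

theorem two_mul_pathStep (i : ℕ) (hi : 1 ≤ i) : 2 * i * pathStep i = π := by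
  have : (i : ℝ) ≠ 0 := by positivity
  unfold pathStep
  field_simp

theorem pathStep_pos (i : ℕ) (hi : 1 ≤ i) : 0 < pathStep i := by
  unfold pathStep
  have : (0 : ℝ) < i := by positivity
  positivity

theorem sin_odd_mul_pathStep_pos (i m : ℕ) (hm : m < i) : 0 < sin ((2 * m + 1) * pathStep i) := by
  have h1 := two_mul_pathStep i (by omega)
  have h2 := pathStep_pos i (by omega)
  have h3 : (m : ℝ) + 1 ≤ i := by exact_mod_cast hm
  apply sin_pos_of_pos_of_lt_pi
  · positivity
  · nlinarith

theorem pathTopEigenvalue_le_cos (i : ℕ) (hi : 1 ≤ i) :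
    pathTopEigenvalue i ≤ 2 + 2 * cos (2 * pathStep i) := by
  have hpi := two_mul_pathStep i hi
  refine pathTopEigenvalue_le i hi (fun j => sin ((2 * j - 1) * pathStep i)) _ ?_ ?_ ?_ ?_
  · intro j hj
    have := sin_odd_mul_pathStep_pos i j hj
    convert this using 2
    push_cast
    ring
  · simp only [Nat.cast_zero, Nat.cast_one]
    rw [← sin_neg]
    congr 1
    ring
  · push_cast
    rw [show (2 * ((i : ℝ) + 1) - 1) * pathStep i = pathStep i + π by linarith, sin_add_pi,
      show (2 * (i : ℝ) - 1) * pathStep i = π - pathStep i by linarith, sin_pi_sub]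
  · intro j
    push_cast
    rw [show (2 * (j : ℝ) - 1) * pathStep i = (2 * (j + 1) - 1) * pathStep i - 2 * pathStep i by ring,
      show (2 * ((j : ℝ) + 2) - 1) * pathStep i = (2 * (j + 1) - 1) * pathStep i + 2 * pathStep i by
        ring, sin_sub, sin_add]
    ring

/-- For `lam = 2 + 2 cos (2x)` with `x = π / (2i)`, equality in `le_add` together with `β 0 = 0`
determines the masses. The recurrence is solved by ratios of consecutive entries `sin ((2m ± 1) x)`
of the alternating top eigenvector of the path, and `le_last` is its condition at the far end. -/
theorem exists_isMassSequence (i : ℕ) (hi : 2 ≤ i) (lam : ℝ)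
    (hlam : lam ≤ 2 + 2 * cos (2 * pathStep i)) : ∃ β, IsMassSequence lam i β := by
  set x := pathStep i with hx
  have hpi : 2 * i * x = π := two_mul_pathStep i (by omega)
  have hx0 : 0 < x := pathStep_pos i (by omega)
  have hi' : (2 : ℝ) ≤ i := by exact_mod_cast hi
  have hS : ∀ m : ℕ, m < i → 0 < sin ((2 * m + 1) * x) := sin_odd_mul_pathStep_pos i
  have hx2 : x ≤ π / 2 := by nlinarith
  have hcos : 0 ≤ cos x := cos_nonneg_of_mem_Icc ⟨by linarith, hx2⟩
  -- This product form suits subadditivity; the equivalent form `hβ` suits the recurrence.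
  let β : ℕ → ℝ := fun m => 2 * cos x * sin (2 * m * x) / sin ((2 * m + 1) * x)
  have hβ : ∀ m : ℕ, m < i → β m = 1 + sin ((2 * m - 1) * x) / sin ((2 * m + 1) * x) := by
    intro m hm
    have h := (hS m hm).ne'
    simp only [β]
    rw [eq_comm, one_add_div h]
    congr 1
    rw [show (2 * (m : ℝ) + 1) * x = 2 * m * x + x by ring,
      show (2 * (m : ℝ) - 1) * x = 2 * m * x - x by ring, sin_add, sin_sub]
    ring
  refine ⟨β, ?_, ?_, ?_, ?_, ?_⟩
  · simp [β]
  · intro a b hab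
    have ha := hS a (by omega)
    have hb := hS b (by omega)
    have hc := hS (a + b) hab
    have hab' : (a : ℝ) + b + 1 ≤ i := by exact_mod_cast hab
    have ha0 : (0 : ℝ) ≤ a := Nat.cast_nonneg a
    have hb0 : (0 : ℝ) ≤ b := Nat.cast_nonneg b
    have key := sin_mul_add_ge (2 * a * x) (2 * b * x) x
      (sin_nonneg_of_nonneg_of_le_pi (by positivity) (by nlinarith))
      (sin_nonneg_of_nonneg_of_le_pi (by positivity) (by nlinarith))
      (sin_nonneg_of_nonneg_of_le_pi (by positivity) (by nlinarith))
    simp only [β]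
    push_cast at hc ⊢
    rw [show 2 * (a : ℝ) * x + 2 * b * x = 2 * (a + b) * x by ring,
      show 2 * (a : ℝ) * x + x = (2 * a + 1) * x by ring,
      show 2 * (b : ℝ) * x + x = (2 * b + 1) * x by ring,
      show 2 * ((a : ℝ) + b) * x + x = (2 * (a + b) + 1) * x by ring] at key
    rw [div_add_div _ _ ha.ne' hb.ne', div_le_div_iff₀ hc (mul_pos ha hb)]
    have := mul_le_mul_of_nonneg_left key (mul_nonneg zero_le_two hcos)
    linarith
  · intro m hm hmi
    rw [hβ m hmi]
    obtain ⟨n, rfl⟩ : ∃ n, m = n + 1 := ⟨m - 1, by omega⟩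
    have h1 := hS n (by omega)
    have h2 := hS (n + 1) hmi
    rw [show (2 * ((n + 1 : ℕ) : ℝ) - 1) * x = (2 * n + 1) * x by push_cast; ring]
    have := div_pos h1 h2
    linarith
  · intro m hm
    refine hlam.trans (le_of_eq ?_)
    have h1 := hS m (by omega)
    have h2 := hS (m + 1) hm
    rw [hβ m (by omega), hβ (m + 1) hm,
      show (2 * ((m + 1 : ℕ) : ℝ) - 1) * x = (2 * m + 1) * x by push_cast; ring, add_sub_cancel_left]
    have e : sin ((2 * m - 1) * x) + sin ((2 * ((m + 1 : ℕ) : ℝ) + 1) * x) =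
        2 * cos (2 * x) * sin ((2 * m + 1) * x) := by
      push_cast
      rw [show (2 * (m : ℝ) - 1) * x = (2 * m + 1) * x - 2 * x by ring,
        show (2 * ((m : ℝ) + 1) + 1) * x = (2 * m + 1) * x + 2 * x by ring, sin_sub, sin_add]
      ring
    have h1' := h1.ne'
    have h2' := h2.ne'
    set S₀ := sin ((2 * m - 1) * x)
    set S₁ := sin ((2 * m + 1) * x)
    set S₂ := sin ((2 * ((m + 1 : ℕ) : ℝ) + 1) * x)
    field_simp
    linear_combination -e
  · refine hlam.trans (le_of_eq ?_)
    have hs := sin_pos_of_pos_of_lt_pi hx0 (by linarith [pi_pos])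
    simp only [β]
    rw [Nat.cast_sub (by omega), Nat.cast_one,
      show 2 * ((i : ℝ) - 1) * x = π - 2 * x by linarith,
      show (2 * ((i : ℝ) - 1) + 1) * x = π - x by linarith, sin_pi_sub, sin_pi_sub, sin_two_mul,
      cos_two_mul]
    field_simp
    ring

/-- The first Dirichlet eigenvalue of the path with unit weights, as a lower bound. -/
theorem path_gaps_ge (k : ℕ) (hk : 1 ≤ k) (a : ℕ → ℝ) (ha : a 0 = 0) :
    (2 - 2 * cos (π / (2 * k + 1))) * ∑ j ∈ Finset.range k, a (j + 1) ^ 2 ≤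
      ∑ j ∈ Finset.range k, (a (j + 1) - a j) ^ 2 := by
  set θ := π / (2 * k + 1) with hθ
  have hθpi : (2 * k + 1) * θ = π := by
    rw [hθ]
    field_simp
  have hθ0 : 0 < θ := by positivity
  have hS : ∀ m : ℕ, m < k → 0 < sin ((m + 1) * θ) := by
    intro m hm
    have : (m : ℝ) + 1 ≤ k := by exact_mod_cast hm
    apply sin_pos_of_pos_of_lt_pi
    · positivity
    · nlinarith
  have hrec : ∀ m : ℕ, sin (m * θ) + sin ((m + 2) * θ) = 2 * cos θ * sin ((m + 1) * θ) := by
    intro m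
    rw [show (m : ℝ) * θ = (m + 1) * θ - θ by ring,
      show ((m : ℝ) + 2) * θ = (m + 1) * θ + θ by ring, sin_sub, sin_add]
    ring
  -- Completing squares against the positive Dirichlet eigenvector `sin (j θ)`; the extra term is
  -- the remainder at the right end.
  have key : ∀ m, m < k →
      (2 - 2 * cos θ) * ∑ j ∈ Finset.range (m + 1), a (j + 1) ^ 2 +
        (sin ((m + 2) * θ) / sin ((m + 1) * θ) - 1) * a (m + 1) ^ 2 ≤
      ∑ j ∈ Finset.range (m + 1), (a (j + 1) - a j) ^ 2 := by
    intro m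
    induction m with
    | zero =>
      intro h
      have h0 := hS 0 h
      have h1 := hrec 0
      have : sin (((0 : ℕ) + 2) * θ) / sin (((0 : ℕ) + 1) * θ) = 2 * cos θ := by
        rw [div_eq_iff h0.ne', ← h1]
        simp
      rw [this]
      simp only [zero_add, Finset.sum_range_one, ha]
      linarith
    | succ m ih =>
      intro hm
      have h0 := hS m (by omega)
      have h1 := hS (m + 1) hm
      have h2 := hrec (m + 1)
      have h3 := ih (by omega)
      rw [Finset.sum_range_succ, Finset.sum_range_succ _ (m + 1)]
      push_cast at h1 h2 ⊢
      rw [show (m : ℝ) + 1 + 1 = m + 2 by ring] at h1 h2 ⊢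
      have e1 : sin ((m + 1 + 2) * θ) / sin ((m + 2) * θ) =
          2 * cos θ - sin ((m + 1) * θ) / sin ((m + 2) * θ) := by
        rw [div_eq_iff h1.ne', sub_mul, div_mul_cancel₀ _ h1.ne']
        linarith
      rw [e1]
      have e2 : 0 ≤ (sin ((m + 2) * θ) * a (m + 1) - sin ((m + 1) * θ) * a (m + 2)) ^ 2 /
          (sin ((m + 1) * θ) * sin ((m + 2) * θ)) := div_nonneg (sq_nonneg _) (mul_pos h0 h1).le
      have e3 : (sin ((m + 2) * θ) * a (m + 1) - sin ((m + 1) * θ) * a (m + 2)) ^ 2 /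
          (sin ((m + 1) * θ) * sin ((m + 2) * θ)) =
          sin ((m + 2) * θ) / sin ((m + 1) * θ) * a (m + 1) ^ 2 +
          sin ((m + 1) * θ) / sin ((m + 2) * θ) * a (m + 2) ^ 2 - 2 * (a (m + 1) * a (m + 2)) := by
        have h0' := h0.ne'
        have h1' := h1.ne'
        set S₀ := sin ((m + 1) * θ)
        set S₁ := sin ((m + 2) * θ)
        field_simp
        ring
      rw [e3] at e2
      simp only [show m + 1 + 1 = m + 2 by rfl]
      nlinarith
  obtain ⟨n, rfl⟩ : ∃ n, k = n + 1 := ⟨k - 1, by omega⟩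
  have h := key n (by omega)
  -- Since `(2k + 1) θ = π`, the eigenvector takes equal values at `k` and `k + 1`, the Neumann
  -- condition at the free end, and the remainder vanishes.
  have e : sin ((n + 2) * θ) / sin ((n + 1) * θ) = 1 := by
    rw [div_eq_one_iff_eq (hS n (by omega)).ne', ← sin_pi_sub]
    congr 1
    push_cast at hθpi
    linarith
  rw [e, sub_self, zero_mul, add_zero] at h
  exact h

theorem two_sub_two_cos_pos (k : ℕ) : 0 < 2 - 2 * cos (π / (2 * k + 1)) := by
  have : cos (π / (2 * k + 1)) < cos 0 := by
    apply cos_lt_cos_of_nonneg_of_le_pi le_rfl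
    · exact div_le_self pi_pos.le (by have : (0 : ℝ) ≤ k := Nat.cast_nonneg k; linarith)
    · positivity
  rw [cos_zero] at this
  linarith

theorem two_sub_two_cos_lt_one (k : ℕ) (hk : 2 ≤ k) : 2 - 2 * cos (π / (2 * k + 1)) < 1 := by
  have : cos (π / 3) < cos (π / (2 * k + 1)) := by
    apply cos_lt_cos_of_nonneg_of_le_pi
    · positivity
    · linarith [pi_pos]
    · have : (2 : ℝ) ≤ k := by exact_mod_cast hk
      exact div_lt_div_of_pos_left pi_pos (by norm_num) (by linarith)
  rw [cos_pi_div_three] at this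
  linarith

end Trigonometry

/-! ### From constrained energy bounds to Steklov eigenvalues -/

section Steklov

variable {V : Type*} [Fintype V] {G : SimpleGraph V} {B : Set V}

theorem eq_harmonicExtension_unitWeight (hG : G.Connected) (hB : B.Nonempty) (f : B → ℝ) :
    (∀ x : B, harmonicExtension (fun _ => 1) (unitWeight G) B f x = f x) ∧
      ∀ x ∉ B, laplacian (fun _ => 1) (unitWeight G)
        (harmonicExtension (fun _ => 1) (unitWeight G) B f) x = 0 :=
  (eq_harmonicExtension_iff G hG _ _ (fun _ => one_pos) (unitWeight_comm G) (unitWeight_nonneg G)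
    (fun x y h => by simp [unitWeight, h]) B hB f _).1 rfl

theorem dirichletToNeumann_form (hG : G.Connected) (hB : B.Nonempty) [Fintype B] (f g : B → ℝ) :
    ∑ x, dirichletToNeumann (fun _ => 1) (unitWeight G) B f x * g x =
      ∑ x, (-laplacian (fun _ => 1) (unitWeight G))
        (harmonicExtension (fun _ => 1) (unitWeight G) B f) x *
          harmonicExtension (fun _ => 1) (unitWeight G) B g x := by
  rw [← sum_subtype_eq B]
  · refine Finset.sum_congr rfl fun x _ => ?_
    rw [(eq_harmonicExtension_unitWeight hG hB g).1]
    rfl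
  · intro x hx
    rw [LinearMap.neg_apply, Pi.neg_apply, (eq_harmonicExtension_unitWeight hG hB f).2 x hx]
    ring

theorem dirichletToNeumann_symmetric (hG : G.Connected) (hB : B.Nonempty) [Fintype B]
    (f g : B → ℝ) :
    ∑ x, dirichletToNeumann (fun _ => 1) (unitWeight G) B f x * g x =
      ∑ x, f x * dirichletToNeumann (fun _ => 1) (unitWeight G) B g x := by
  rw [dirichletToNeumann_form hG hB, laplacian_symmetric _ (unitWeight_comm G),
    Finset.sum_congr rfl fun x _ => mul_comm (f x) _, dirichletToNeumann_form hG hB]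
  exact Finset.sum_congr rfl fun x _ => mul_comm _ _

theorem laplacian_form_self (u : V → ℝ) :
    ∑ x, (-laplacian (fun _ => 1) (unitWeight G)) u x * u x = energyOn G Finset.univ u := by
  rw [laplacian_form _ (unitWeight_comm G), energyOn]
  simp only [sq]

/-- A function that vanishes off the boundary has energy at least `∑ u²`. -/
theorem sum_sq_le_energyOn (hGB : IsGraphWithBoundary G B) (u : V → ℝ) (hu : ∀ x ∉ B, u x = 0) :
    ∑ x, u x ^ 2 ≤ energyOn G Finset.univ u := by
  rw [← laplacian_form_self]
  refine Finset.sum_le_sum fun x _ => ?_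
  by_cases hx : x ∈ B
  · obtain ⟨y, hy, hxy⟩ := hGB.exists_adj x hx
    have e : (-laplacian (fun _ => 1) (unitWeight G)) u x * u x =
        ∑ z, unitWeight G x z * u x ^ 2 := by
      simp only [LinearMap.neg_apply, Pi.neg_apply, laplacian, LinearMap.coe_mk, AddHom.coe_mk,
        div_one, one_mul]
      rw [← Finset.sum_neg_distrib, Finset.sum_mul]
      refine Finset.sum_congr rfl fun z _ => ?_
      by_cases hz : z ∈ B
      · simp [unitWeight, hGB.not_adj x hx z hz]
      · rw [hu z hz]
        ring
    rw [e]
    refine le_trans (le_of_eq ?_) (Finset.single_le_sum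
      (fun z _ => mul_nonneg (unitWeight_nonneg G x z) (sq_nonneg (u x))) (Finset.mem_univ y))
    simp [unitWeight, hxy]
  · simp [hu x hx]

/-- Lower bounds of the energy under fewer than `i` constraints bound `σ_i` from below. -/
theorem le_steklovEigenvalue (hG : G.Connected) (hGB : IsGraphWithBoundary G B) {i : ℕ}
    (hi : 1 ≤ i) (hiB : i ≤ B.ncard) {c : ℝ} (hc : 0 ≤ c)
    (h : ∃ l : List (Module.Dual ℝ (V → ℝ)), l.length ≤ i - 1 ∧ ∀ u : V → ℝ,
      (∀ φ ∈ l, φ u = 0) → c * ∑ x, u x ^ 2 ≤ energyOn G Finset.univ u) :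
    c ≤ steklovEigenvalue (fun _ => 1) (unitWeight G) B i ∧
      (0 < c → c < 1 → c < steklovEigenvalue (fun _ => 1) (unitWeight G) B i) := by
  classical
  obtain ⟨l, hl, H⟩ := h
  have hB : B.Nonempty := Set.nonempty_of_ncard_ne_zero (by omega)
  have hcard : Fintype.card B = B.ncard := by
    rw [← Nat.card_eq_fintype_card, Nat.card_coe_set_eq]
  obtain ⟨f, hf0, hAf, hf⟩ := exists_rayleigh_le_orderedEigenvalue
    (dirichletToNeumann (fun _ => 1) (unitWeight G) B) (dirichletToNeumann_symmetric hG hB) i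
    (hcard ▸ hiB) l.length (by omega)
    (LinearMap.pi fun j => l.get j ∘ₗ harmonicExtension (fun _ => 1) (unitWeight G) B)
  rw [dirichletToNeumann_form hG hB] at hf
  obtain ⟨hu, -⟩ := eq_harmonicExtension_unitWeight hG hB f
  set u := harmonicExtension (fun _ => 1) (unitWeight G) B f
  change _ ≤ steklovEigenvalue (fun _ => 1) (unitWeight G) B i * _ at hf
  set σ := steklovEigenvalue (fun _ => 1) (unitWeight G) B i
  rw [laplacian_form_self] at hf
  have hE := H u (by
    intro φ hφ
    obtain ⟨j, hj, rfl⟩ := List.getElem_of_mem hφ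
    exact congrFun hAf ⟨j, hj⟩)
  have hsplit : ∑ x, u x ^ 2 = ∑ x, f x * f x + ∑ x, if x ∈ B then 0 else u x ^ 2 := by
    have : ∑ x, f x * f x = ∑ x, if x ∈ B then u x ^ 2 else 0 := by
      rw [← sum_subtype_eq B]
      · refine Finset.sum_congr rfl fun x _ => ?_
        rw [if_pos x.2, hu, sq]
      · exact fun x hx => if_neg hx
    rw [this, ← Finset.sum_add_distrib]
    refine Finset.sum_congr rfl fun x _ => ?_
    split_ifs <;> simp
  have hnn : ∀ x ∈ Finset.univ, 0 ≤ if x ∈ B then 0 else u x ^ 2 := by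
    intro x _
    split_ifs
    · exact le_rfl
    · exact sq_nonneg _
  have hN := Finset.sum_nonneg hnn
  have hpos : 0 < ∑ x, f x * f x := by
    refine lt_of_le_of_ne (Finset.sum_nonneg fun _ _ => mul_self_nonneg _) fun h0 => hf0 ?_
    rw [eq_comm, Finset.sum_eq_zero_iff_of_nonneg fun _ _ => mul_self_nonneg _] at h0
    funext x
    exact mul_self_eq_zero.1 (h0 x (Finset.mem_univ x))
  rw [hsplit] at hE
  have hle : c ≤ σ := by
    refine le_of_mul_le_mul_right ?_ hpos
    have := mul_nonneg hc hN
    linarith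
  refine ⟨hle, fun hc0 hc1 => lt_of_le_of_ne hle fun heq => ?_⟩
  rw [← heq] at hf
  -- If `σ = c`, a positive amount of `∑ u²` off `B` would contradict the Rayleigh bound; so `u`
  -- lives on `B`, where the energy is at least `∑ u²`, against `c < 1`.
  have hz : ∑ x, (if x ∈ B then 0 else u x ^ 2) = 0 := by
    refine le_antisymm ?_ hN
    by_contra hlt
    push Not at hlt
    have := mul_pos hc0 hlt
    linarith
  have hz' := (Finset.sum_eq_zero_iff_of_nonneg hnn).1 hz
  have hb := sum_sq_le_energyOn hGB u fun x hx => by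
    have := hz' x (Finset.mem_univ x)
    rw [if_neg hx] at this
    exact pow_eq_zero_iff two_ne_zero |>.1 this
  rw [hsplit, hz] at hb
  nlinarith

theorem IsGraphWithBoundary.ncard_lt_card (hGB : IsGraphWithBoundary G B) (hB : B.Nonempty) :
    B.ncard < Fintype.card V := by
  obtain ⟨x, hx⟩ := hB
  obtain ⟨y, hy, -⟩ := hGB.exists_adj x hx
  rw [← Nat.card_eq_fintype_card, ← Set.ncard_univ]
  exact Set.ncard_lt_ncard (Set.ssubset_univ_iff.2 fun h => hy (h ▸ Set.mem_univ y))

theorem two_sub_two_cos_le_steklovEigenvalue (hG : G.Connected) (hGB : IsGraphWithBoundary G B)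
    {i : ℕ} (hi : 2 ≤ i) (hiB : i ≤ B.ncard) :
    2 - 2 * Real.cos (Real.pi / (2 * ((Fintype.card V / i : ℕ) : ℝ) + 1)) ≤
        steklovEigenvalue (fun _ => 1) (unitWeight G) B i ∧
      (2 ≤ Fintype.card V / i →
        2 - 2 * Real.cos (Real.pi / (2 * ((Fintype.card V / i : ℕ) : ℝ) + 1)) <
          steklovEigenvalue (fun _ => 1) (unitWeight G) B i) := by
  have hlt := hGB.ncard_lt_card (Set.nonempty_of_ncard_ne_zero (by omega))
  have hk : 1 ≤ Fintype.card V / i := (Nat.one_le_div_iff (by omega)).2 (by omega)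
  have hpos := two_sub_two_cos_pos (Fintype.card V / i)
  have h := le_steklovEigenvalue hG hGB (by omega) hiB hpos.le
    (exists_constraints_of_card_lt hG hi hk (Nat.lt_mul_div_succ _ (by omega))
      (path_gaps_ge _ hk))
  exact ⟨h.1, fun h2 => h.2 hpos (two_sub_two_cos_lt_one _ h2)⟩

theorem pathDirichlet_lt_steklovEigenvalue (hG : G.Connected) (hGB : IsGraphWithBoundary G B)
    {i : ℕ} (hi : 2 ≤ i) (hiB : i ≤ B.ncard) (hdvd : i ∣ Fintype.card V) :
    pathDirichlet (Fintype.card V / i) (pathTopEigenvalue i) <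
      steklovEigenvalue (fun _ => 1) (unitWeight G) B i := by
  have hlt := hGB.ncard_lt_card (Set.nonempty_of_ncard_ne_zero (by omega))
  obtain ⟨k, hk⟩ := hdvd
  have hk2 : 2 ≤ k := by
    by_contra h
    have : k = 0 ∨ k = 1 := by omega
    rcases this with rfl | rfl <;> omega
  have hdiv : Fintype.card V / i = k := by
    rw [hk, Nat.mul_div_cancel_left _ (by omega)]
  have htop := pathTopEigenvalue_le_cos i (by omega)
  -- A nonpositive value lies below the positive trigonometric bound, which holds without any
  -- divisibility condition. This spares a proof that `𝒫` is positive.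
  rcases le_or_gt (pathDirichlet (Fintype.card V / i) (pathTopEigenvalue i)) 0 with h | h
  · exact h.trans_lt ((two_sub_two_cos_pos _).trans_le
      (two_sub_two_cos_le_steklovEigenvalue hG hGB hi hiB).1)
  · rw [hdiv] at h ⊢
    obtain ⟨β, hβ⟩ := exists_isMassSequence i hi _ htop
    exact (le_steklovEigenvalue hG hGB (by omega) hiB h.le
      (exists_constraints_of_card_eq_mul hG hi hk2 hβ hk
        (pathDirichlet_mul_le k (by omega) _))).2 h
      (pathDirichlet_lt_one k hk2 _ (by linarith [Real.cos_le_one (2 * pathStep i)]))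

/-- Only one vertex lies outside `B`. Each boundary vertex needs an interior neighbour, necessarily
this one, and no two boundary vertices are adjacent. -/
theorem exists_eq_starGraph (hGB : IsGraphWithBoundary G B) (hB : B.Nonempty)
    (h : Fintype.card V ≤ B.ncard + 1) :
    ∃ o : V, G = SimpleGraph.starGraph o ∧ ∀ x : V, x ∈ B ↔ x ≠ o := by
  have hlt := hGB.ncard_lt_card hB
  have hc : Bᶜ.ncard = 1 := by
    have := Set.ncard_add_ncard_compl B
    rw [Nat.card_eq_fintype_card] at this
    omega
  obtain ⟨o, ho⟩ := Set.ncard_eq_one.1 hc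
  have hmem : ∀ x, x ∈ B ↔ x ≠ o := by
    intro x
    have : x ∈ Bᶜ ↔ x ∈ ({o} : Set V) := by rw [ho]
    rw [Set.mem_compl_iff, Set.mem_singleton_iff] at this
    tauto
  have hadj : ∀ x, x ≠ o → G.Adj x o := by
    intro x hx
    obtain ⟨y, hy, hxy⟩ := hGB.exists_adj x ((hmem x).2 hx)
    rw [hmem, not_not] at hy
    exact hy ▸ hxy
  refine ⟨o, ?_, hmem⟩
  ext x y
  rw [SimpleGraph.starGraph, SimpleGraph.fromRel_adj]
  constructor
  · intro hxy
    refine ⟨hxy.ne, ?_⟩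
    by_contra hno
    push Not at hno
    exact hGB.not_adj x ((hmem x).2 hno.1) y ((hmem y).2 hno.2) hxy
  · rintro ⟨hne, rfl | rfl⟩
    · exact (hadj y hne.symm).symm
    · exact hadj x hne

/-- On a star the harmonic value at the center is the mean of `f`, and `Λ` subtracts it from `f`.
Hence `⟨Λf, f⟩ = ∑ f² - |B| u(o)² ≤ ∑ f²`. -/
theorem steklovEigenvalue_starGraph_le (o : V) (hG : (SimpleGraph.starGraph o).Connected)
    (hmem : ∀ x : V, x ∈ B ↔ x ≠ o) {i : ℕ} (hi : 1 ≤ i) (hiB : i ≤ B.ncard) :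
    steklovEigenvalue (fun _ => 1) (unitWeight (SimpleGraph.starGraph o)) B i ≤ 1 := by
  classical
  have hB : B.Nonempty := Set.nonempty_of_ncard_ne_zero (by omega)
  have hcard : Fintype.card B = B.ncard := by
    rw [← Nat.card_eq_fintype_card, Nat.card_coe_set_eq]
  obtain ⟨f, hf0, hf⟩ := exists_eigenvector_orderedEigenvalue
    (dirichletToNeumann (fun _ => 1) (unitWeight (SimpleGraph.starGraph o)) B)
    (dirichletToNeumann_symmetric hG hB) i hi (hcard ▸ hiB)
  change _ = steklovEigenvalue (fun _ => 1) (unitWeight (SimpleGraph.starGraph o)) B i • f at hf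
  set σ := steklovEigenvalue (fun _ => 1) (unitWeight (SimpleGraph.starGraph o)) B i
  obtain ⟨hu, hharm⟩ := eq_harmonicExtension_unitWeight hG hB f
  have hN : ∀ x : B, dirichletToNeumann (fun _ => 1) (unitWeight (SimpleGraph.starGraph o)) B f x =
      (-laplacian (fun _ => 1) (unitWeight (SimpleGraph.starGraph o)))
        (harmonicExtension (fun _ => 1) (unitWeight (SimpleGraph.starGraph o)) B f) x := fun _ => rfl
  set u := harmonicExtension (fun _ => 1) (unitWeight (SimpleGraph.starGraph o)) B f
  have hstar : ∀ x ∈ B, ∀ y, unitWeight (SimpleGraph.starGraph o) x y = if y = o then 1 else 0 := by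
    intro x hx y
    rw [hmem] at hx
    have : (SimpleGraph.starGraph o).Adj x y ↔ y = o := by
      rw [SimpleGraph.starGraph, SimpleGraph.fromRel_adj]
      constructor
      · rintro ⟨-, h | h⟩
        · exact absurd h hx
        · exact h
      · rintro rfl
        exact ⟨hx, Or.inr rfl⟩
    simp only [unitWeight, this]
  have hL : ∀ x : B, σ * f x = f x - u o := by
    intro x
    have h1 := congrFun hf x
    rw [hN, Pi.smul_apply, smul_eq_mul] at h1
    rw [← h1]
    simp [laplacian, hstar x x.2, hu]
  have hsum : ∑ x : B, (f x - u o) = 0 := by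
    have h1 := hharm o (by simp [hmem])
    simp only [laplacian, LinearMap.coe_mk, AddHom.coe_mk, div_one, one_mul] at h1
    rw [← h1, ← sum_subtype_eq B]
    · refine Finset.sum_congr rfl fun x _ => ?_
      rw [unitWeight_comm, hstar x x.2, if_pos rfl, hu, mul_one]
    · intro x hx
      rw [hmem, not_not] at hx
      rw [hx]
      ring
  have hpos : 0 < ∑ x, f x * f x := by
    refine lt_of_le_of_ne (Finset.sum_nonneg fun _ _ => mul_self_nonneg _) fun h0 => hf0 ?_
    rw [eq_comm, Finset.sum_eq_zero_iff_of_nonneg fun _ _ => mul_self_nonneg _] at h0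
    funext x
    exact mul_self_eq_zero.1 (h0 x (Finset.mem_univ x))
  refine le_of_mul_le_mul_right ?_ hpos
  have e1 : σ * ∑ x, f x * f x = ∑ x, f x * f x - u o * ∑ x : B, f x := by
    rw [Finset.mul_sum, Finset.mul_sum, ← Finset.sum_sub_distrib]
    refine Finset.sum_congr rfl fun x _ => ?_
    rw [← mul_assoc, hL]
    ring
  have e2 : ∑ x : B, f x = Fintype.card B * u o := by
    rw [Finset.sum_sub_distrib] at hsum
    simp only [Finset.sum_const, Finset.card_univ, nsmul_eq_mul] at hsum
    linarith
  rw [e1, e2]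
  have : 0 ≤ u o * (Fintype.card B * u o) := by
    have : u o * (Fintype.card B * u o) = Fintype.card B * (u o * u o) := by ring
    rw [this]
    exact mul_nonneg (Nat.cast_nonneg _) (mul_self_nonneg _)
  linarith

end Steklov

end SteklovGraph

theorem mainTheorem5 {V : Type*} [Fintype V] (G : SimpleGraph V) (hG : G.Connected) (B : Set V)
    (hB : SteklovGraph.IsGraphWithBoundary G B) (i : ℕ) (hi : 2 ≤ i) (hiB : i ≤ B.ncard) :
    (¬ i ∣ Fintype.card V →
      2 - 2 * Real.cos (Real.pi / (2 * ((Fintype.card V / i : ℕ) : ℝ) + 1)) ≤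
        SteklovGraph.steklovEigenvalue (fun _ => 1) (SteklovGraph.unitWeight G) B i) ∧
    (Fintype.card V ≡ 1 [MOD i] →
      (SteklovGraph.steklovEigenvalue (fun _ => 1) (SteklovGraph.unitWeight G) B i =
          2 - 2 * Real.cos (Real.pi / (2 * ((Fintype.card V / i : ℕ) : ℝ) + 1)) ↔
        Fintype.card V / i = 1 ∧ Fintype.card V = i + 1 ∧
          ∃ o : V, G = SimpleGraph.starGraph o ∧ ∀ x : V, x ∈ B ↔ x ≠ o)) ∧
    (i ∣ Fintype.card V →
      SteklovGraph.pathDirichlet (Fintype.card V / i) (SteklovGraph.pathTopEigenvalue i) <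
        SteklovGraph.steklovEigenvalue (fun _ => 1) (SteklovGraph.unitWeight G) B i) := by
  have hne : B.Nonempty := Set.nonempty_of_ncard_ne_zero (by omega)
  have hlt := hB.ncard_lt_card hne
  obtain ⟨hle, hstrict⟩ := SteklovGraph.two_sub_two_cos_le_steklovEigenvalue hG hB hi hiB
  refine ⟨fun _ => hle, fun hmod => ⟨fun heq => ?_, ?_⟩,
    SteklovGraph.pathDirichlet_lt_steklovEigenvalue hG hB hi hiB⟩
  -- The bound is strict for `k ≥ 2`, so equality leaves `k = 1`; then `|V| = i + 1 ≤ |B| + 1`,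
  -- which forces the star.
  · have hk1 : Fintype.card V / i = 1 := by
      have h1 : 1 ≤ Fintype.card V / i := (Nat.one_le_div_iff (by omega)).2 (by omega)
      by_contra h
      exact (hstrict (by omega)).ne' heq
    have hcard : Fintype.card V = i + 1 := by
      have h1 : Fintype.card V % i = 1 % i := hmod
      rw [Nat.mod_eq_of_lt (by omega : 1 < i)] at h1
      have h2 := Nat.div_add_mod (Fintype.card V) i
      rw [hk1, h1, mul_one] at h2
      exact h2.symm
    exact ⟨hk1, hcard, SteklovGraph.exists_eq_starGraph hB hne (by omega)⟩
  · rintro ⟨hk1, -, o, rfl, hmem⟩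
    refine le_antisymm ?_ hle
    -- For `k = 1` the bound is `2 - 2 cos (π / 3) = 1`.
    refine (SteklovGraph.steklovEigenvalue_starGraph_le o hG hmem (by omega) hiB).trans (le_of_eq ?_)
    rw [hk1, show Real.pi / (2 * ((1 : ℕ) : ℝ) + 1) = Real.pi / 3 by norm_num,
      Real.cos_pi_div_three]
    norm_num
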